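/- Fix $T>0$, a filtered probability space $(\Omega,\mathcal F,(\mathcal F_t)_{0\le t\le T},\mathbb P)$ satisfying the usual conditions, and constants $\lambda,\gamma,\kappa,\rho,\varrho,\phi,y>0$. Let $P=(P_t)_{0\le t\le T}$ be an adapted semimartingale with canonical decomposition $P=P_0+L+A$, where $L$ is a local martingale and $A$ a predictable process of finite variation, $L_0=A_0=0$, such that $$E[\langle L\rangle_T]+E\Big[\Big(\int_0^T|dA_s|\Big)^2\Big]<\infty .$$ Let $\mathcal A$ be the set of progressively measurable processes $v$ with $E[\int_0^T v_s^2\,ds]<\infty$. Let $(x^i)_{i\ge1}$ be real numbers (the initial inventories) with $\sup_{i\ge1}|x^i|<\infty$, and assume $$20\,C\,(T^2\vee1)\,T^2<1,\qquad C=16\Big(\frac{\max\{\varrho,\kappa,\rho\kappa,\kappa\gamma,\phi,\rho\}}{\lambda}\Big)^2 .$$ (i) For every $N\ge2$ let $\hat u^{1,N},\dots,\hat u^{N,N}\in\mathcal A$ (the equilibrium trading speeds of the $N$-player game) solve, together with processes $X^{i,N},Y^N,Z^{i,N}$ and square integrable martingales $M^{i,N},N^{i,N}$, $i=1,\dots,N$,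 the forward-backward system $$dX^{i,N}_t=-\hat u^{i,N}_t\,dt,\quad X^{i,N}_0=x^i;\qquad dY^N_t=-\rho Y^N_t\,dt+\frac{\gamma}{N}\sum_{j=1}^N\hat u^{j,N}_t\,dt,\quad Y^N_0=y;$$ $$d\hat u^{i,N}_t=\frac{dP_t}{2\lambda}+\frac{\kappa\rho}{2\lambda}Y^N_t\,dt-\frac{\gamma\kappa}{2\lambda N}\sum_{j\ne i}\hat u^{j,N}_t\,dt-\frac{\phi}{\lambda}X^{i,N}_t\,dt+\frac{\rho}{2\lambda}Z^{i,N}_t\,dt+dM^{i,N}_t,\quad \hat u^{i,N}_T=\frac{\varrho}{\lambda}X^{i,N}_T-\frac{\kappa}{2\lambda}Y^N_T;$$ $$dZ^{i,N}_t=\rho Z^{i,N}_t\,dt+\frac{\gamma\kappa}{N}\hat u^{i,N}_t\,dt+dN^{i,N}_t,\quad Z^{i,N}_T=0 .$$ Then $$\limsup_{N\to\infty}\ \sup_{1\le i\le N}\ \sup_{t\in[0,T]}E\big[(\hat u^{i,N}_t)^2\big]<\infty .$$ (ii) Let $(\hat v^i)_{i\ge1}\subset\mathcal A$ (the equilibrium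 trading speeds of the mean field game) solve, together with some $\hat\nu\in\mathcal A$, processes $X^i,Y$ and square integrable martingales $L^i$, the forward-backward systems $$dX^i_t=-\hat v^i_t\,dt,\quad X^i_0=x^i;\qquad dY_t=-\rho Y_t\,dt+\gamma\hat\nu_t\,dt,\quad Y_0=y;$$ $$d\hat v^i_t=\frac{dP_t}{2\lambda}+\frac{\kappa\rho}{2\lambda}Y_t\,dt-\frac{\kappa\gamma}{2\lambda}\hat\nu_t\,dt-\frac{\phi}{\lambda}X^i_t\,dt+dL^i_t,\quad \hat v^i_T=\frac{\varrho}{\lambda}X^i_T-\frac{\kappa}{2\lambda}Y_T,$$ for all $i\ge1$, with $\hat\nu_t=\lim_{N\to\infty}\frac1N\sum_{i=1}^N\hat v^i_t$ for $d\mathbb P\otimes dt$-almost every $(\omega,t)$. Then $$\limsup_{N\to\infty}\ \sup_{1\le i\le N}\ \sup_{t\in[0,T]}E\big[(\hat v^i_t)^2\big]<\infty .$$ -/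

import Mathlib

open MeasureTheory ProbabilityTheory Filter Topology
open scoped ENNReal

noncomputable section

namespace PriceImpactGame

/-- The time interval `[0,T]`. -/
abbrev TimeInterval (T : ℝ) : Type := Set.Icc (0 : ℝ) T

/-- For `T > 0` the time `0` is the least element `⊥` of `[0,T]`, and `T` is the greatest element
`⊤`, by Mathlib's instances, which use the following fact. -/
instance instFactNonneg {T : ℝ} [hT : Fact (0 < T)] : Fact ((0 : ℝ) ≤ T) := ⟨hT.out.le⟩

/-- Lebesgue measure on `[0,T]`. -/
def lebesgue (T : ℝ) : Measure (TimeInterval T) := Measure.comap Subtype.val volume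

/-- `∫₀ᵗ f(s) ds`. -/
def timeIntegral {T : ℝ} (f : TimeInterval T → ℝ) (t : TimeInterval T) : ℝ :=
  ∫ s in Set.Iic t, f s ∂(lebesgue T)

/-- Right continuous with left limits. -/
def IsCadlag {T : ℝ} (f : TimeInterval T → ℝ) : Prop :=
  ∀ t, ContinuousWithinAt f (Set.Ici t) t ∧ ∃ l : ℝ, Tendsto f (𝓝[<] t) (𝓝 l)

section Processes

variable {Ω : Type*} {mΩ : MeasurableSpace Ω} {T : ℝ} [Fact (0 < T)]

/-- The usual conditions: the filtration is right continuous, and `ℱ₀` contains every subset of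
every null set. -/
structure UsualConditions (ℱ : Filtration (TimeInterval T) mΩ) (μ : Measure Ω) : Prop where
  rightContinuous : ℱ.IsRightContinuous
  complete : ∀ s : Set Ω, μ s = 0 → MeasurableSet[ℱ ⊥] s

/-- Càdlàg local martingales on `[0,T]`. A localizing sequence takes values in `[0,T] ∪ {⊤}`, is
a.s. nondecreasing, and a.s. eventually equals `⊤`. -/
structure IsLocalMartingale (ℱ : Filtration (TimeInterval T) mΩ) (μ : Measure Ω)
    (L : TimeInterval T → Ω → ℝ) : Prop where
  adapted : StronglyAdapted ℱ L
  cadlag : ∀ ω, IsCadlag (fun t => L t ω)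
  locally_martingale : Locally (fun X => Martingale X ℱ μ) ℱ L μ

/-- Càdlàg square integrable martingales on `[0,T]`. -/
structure IsSquareIntegrableMartingale (ℱ : Filtration (TimeInterval T) mΩ) (μ : Measure Ω)
    (M : TimeInterval T → Ω → ℝ) : Prop where
  martingale : Martingale M ℱ μ
  memLp : ∀ t, MemLp (M t) 2 μ
  cadlag : ∀ ω, IsCadlag (fun t => M t ω)

/-- `Q = ⟨L⟩` for a local martingale `L` with `L₀ = 0`: the predictable càdlàg nondecreasing
process with `Q₀ = 0` for which `L² - Q` is a local martingale. -/
structure IsPredictableQuadraticVariation (ℱ : Filtration (TimeInterval T) mΩ) (μ : Measure Ω)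
    (L Q : TimeInterval T → Ω → ℝ) : Prop where
  predictable : IsStronglyPredictable ℱ Q
  cadlag : ∀ ω, IsCadlag (fun t => Q t ω)
  monotone : ∀ ω, Monotone (fun t => Q t ω)
  zero : ∀ ω, Q ⊥ ω = 0
  localMartingale : IsLocalMartingale ℱ μ (fun t ω => L t ω ^ 2 - Q t ω)

/-- Predictable càdlàg processes of finite variation. -/
structure IsPredictableFiniteVariation (ℱ : Filtration (TimeInterval T) mΩ)
    (A : TimeInterval T → Ω → ℝ) : Prop where
  predictable : IsStronglyPredictable ℱ A
  cadlag : ∀ ω, IsCadlag (fun t => A t ω)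
  boundedVariation : ∀ ω, BoundedVariationOn (fun t => A t ω) Set.univ

/-- The class `ℋ²` of special semimartingales `P` with canonical decomposition `P = P₀ + L + A`,
`L` a local martingale and `A` a predictable finite variation process, both null at time `0`, with
`E[⟨L⟩_T] + E[(∫₀ᵀ |dA|)²] < ∞`. The initial value `P₀` is an arbitrary `ℱ₀`-measurable random
variable. -/
structure IsH2Semimartingale (ℱ : Filtration (TimeInterval T) mΩ) (μ : Measure Ω)
    (P : TimeInterval T → Ω → ℝ) : Prop where
  adapted : StronglyAdapted ℱ P
  decomposition : ∃ L A Q : TimeInterval T → Ω → ℝ,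
    IsLocalMartingale ℱ μ L ∧ (∀ ω, L ⊥ ω = 0) ∧
    IsPredictableFiniteVariation ℱ A ∧ (∀ ω, A ⊥ ω = 0) ∧
    (∀ᵐ ω ∂μ, ∀ t, P t ω = P ⊥ ω + L t ω + A t ω) ∧
    IsPredictableQuadraticVariation ℱ μ L Q ∧
    (∫⁻ ω, ENNReal.ofReal (Q ⊤ ω) ∂μ)
      + ∫⁻ ω, (eVariationOn (fun t => A t ω) Set.univ) ^ 2 ∂μ < ∞

/-- The admissible strategies `𝒜`: progressively measurable processes with
`E[∫₀ᵀ v_s² ds] < ∞`. -/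
structure Admissible (ℱ : Filtration (TimeInterval T) mΩ) (μ : Measure Ω)
    (v : TimeInterval T → Ω → ℝ) : Prop where
  progressive : IsStronglyProgressive ℱ v
  square_integrable : ∫⁻ ω, ∫⁻ t, ENNReal.ofReal (v t ω ^ 2) ∂(lebesgue T) ∂μ < ∞

/-- Adapted càdlàg processes. -/
structure IsAdaptedCadlag (ℱ : Filtration (TimeInterval T) mΩ)
    (X : TimeInterval T → Ω → ℝ) : Prop where
  adapted : StronglyAdapted ℱ X
  cadlag : ∀ ω, IsCadlag (fun t => X t ω)

end Processes

/-- The model constants: slippage cost `lam` (λ), impact parameters `γ`, `κ`, resilience rate `ρ`,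
terminal penalty `ϱ`, running penalty `φ`, and the initial price distortion `y`. -/
structure Parameters where
  lam : ℝ
  γ : ℝ
  κ : ℝ
  ρ : ℝ
  ϱ : ℝ
  φ : ℝ
  y : ℝ

/-- All model constants are positive. -/
structure Parameters.Positive (p : Parameters) : Prop where
  lam : 0 < p.lam
  γ : 0 < p.γ
  κ : 0 < p.κ
  ρ : 0 < p.ρ
  ϱ : 0 < p.ϱ
  φ : 0 < p.φ
  y : 0 < p.y

/-- The constant `16 (max {ϱ, κ, ρκ, κγ, φ, ρ} / λ)²`. -/
def Parameters.smallTimeConstant (p : Parameters) : ℝ :=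
  16 * (max p.ϱ (max p.κ (max (p.ρ * p.κ) (max (p.κ * p.γ) (max p.φ p.ρ)))) / p.lam) ^ 2

section Systems

variable {Ω : Type*} {mΩ : MeasurableSpace Ω} {T : ℝ} [Fact (0 < T)]

/-- The selling rates `u = (u¹, …, uᴺ)`, started from the inventories `x = (x¹, …, xᴺ)`, solve the
coupled linear forward backward SDE system of the `N`-player game:
`dXⁱ = -uⁱ dt`, `X₀ⁱ = xⁱ`;
`dY = -ρ Y dt + (γ/N) ∑ⱼ uʲ dt`, `Y₀ = y`;
`duⁱ = dP/(2λ) + (κρ/(2λ)) Y dt - (γκ/(2λN)) ∑_{j ≠ i} uʲ dt - (φ/λ) Xⁱ dt + (ρ/(2λ)) Zⁱ dt + dMⁱ`,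
`u_Tⁱ = (ϱ/λ) X_Tⁱ - (κ/(2λ)) Y_T`;
`dZⁱ = ρ Zⁱ dt + (γκ/N) uⁱ dt + dNⁱ`, `Z_Tⁱ = 0`,
for square integrable martingales `Mⁱ`, `Nⁱ` (called `K` below). The equations are written in
integrated form and hold almost surely for all times simultaneously. -/
def SolvesNPlayerFBSDE (p : Parameters) (ℱ : Filtration (TimeInterval T) mΩ) (μ : Measure Ω)
    (P : TimeInterval T → Ω → ℝ) (N : ℕ) (x : Fin N → ℝ)
    (u : Fin N → TimeInterval T → Ω → ℝ) : Prop :=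
  (∀ i, Admissible ℱ μ (u i)) ∧
  ∃ (X : Fin N → TimeInterval T → Ω → ℝ) (Y : TimeInterval T → Ω → ℝ)
    (Z M K : Fin N → TimeInterval T → Ω → ℝ),
    (∀ i, IsAdaptedCadlag ℱ (X i)) ∧ IsAdaptedCadlag ℱ Y ∧ (∀ i, IsAdaptedCadlag ℱ (Z i)) ∧
    (∀ i, IsSquareIntegrableMartingale ℱ μ (M i)) ∧
    (∀ i, IsSquareIntegrableMartingale ℱ μ (K i)) ∧
    (∀ i, ∀ᵐ ω ∂μ, ∀ t, X i t ω = x i - timeIntegral (fun s => u i s ω) t) ∧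
    (∀ᵐ ω ∂μ, ∀ t, Y t ω = p.y +
      timeIntegral (fun s => -p.ρ * Y s ω + p.γ / N * ∑ j, u j s ω) t) ∧
    (∀ i, ∀ᵐ ω ∂μ, ∀ t, u i t ω = u i ⊥ ω + (P t ω - P ⊥ ω) / (2 * p.lam) +
      timeIntegral (fun s => p.κ * p.ρ / (2 * p.lam) * Y s ω
        - p.γ * p.κ / (2 * p.lam * N) * ∑ j ∈ Finset.univ.erase i, u j s ω
        - p.φ / p.lam * X i s ω
        + p.ρ / (2 * p.lam) * Z i s ω) t + (M i t ω - M i ⊥ ω)) ∧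
    (∀ i, ∀ᵐ ω ∂μ, u i ⊤ ω = p.ϱ / p.lam * X i ⊤ ω - p.κ / (2 * p.lam) * Y ⊤ ω) ∧
    (∀ i, ∀ᵐ ω ∂μ, ∀ t, Z i t ω = Z i ⊥ ω +
      timeIntegral (fun s => p.ρ * Z i s ω + p.γ * p.κ / N * u i s ω) t
        + (K i t ω - K i ⊥ ω)) ∧
    (∀ i, ∀ᵐ ω ∂μ, Z i ⊤ ω = 0)

/-- The selling rates `v = (vⁱ)`, started from the inventories `x = (xⁱ)`, solve the coupled linear
forward backward SDE systems of the mean field game, with a mean field trading speed `ν`: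
`dXⁱ = -vⁱ dt`, `X₀ⁱ = xⁱ`;
`dY = -ρ Y dt + γ ν dt`, `Y₀ = y`;
`dvⁱ = dP/(2λ) + (κρ/(2λ)) Y dt - (κγ/(2λ)) ν dt - (φ/λ) Xⁱ dt + dLⁱ`,
`v_Tⁱ = (ϱ/λ) X_Tⁱ - (κ/(2λ)) Y_T`,
for square integrable martingales `Lⁱ`, where `ν` is admissible and equal, `dP ⊗ dt`-almost
everywhere, to the limit of the averages of `v⁰, …, vᴺ⁻¹`. -/
def SolvesMeanFieldFBSDE (p : Parameters) (ℱ : Filtration (TimeInterval T) mΩ) (μ : Measure Ω)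
    (P : TimeInterval T → Ω → ℝ) (x : ℕ → ℝ) (v : ℕ → TimeInterval T → Ω → ℝ) : Prop :=
  (∀ i, Admissible ℱ μ (v i)) ∧
  ∃ (ν : TimeInterval T → Ω → ℝ) (X : ℕ → TimeInterval T → Ω → ℝ) (Y : TimeInterval T → Ω → ℝ)
    (L : ℕ → TimeInterval T → Ω → ℝ),
    Admissible ℱ μ ν ∧
    (∀ i, IsAdaptedCadlag ℱ (X i)) ∧ IsAdaptedCadlag ℱ Y ∧
    (∀ i, IsSquareIntegrableMartingale ℱ μ (L i)) ∧
    (∀ i, ∀ᵐ ω ∂μ, ∀ t, X i t ω = x i - timeIntegral (fun s => v i s ω) t) ∧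
    (∀ᵐ ω ∂μ, ∀ t, Y t ω = p.y + timeIntegral (fun s => -p.ρ * Y s ω + p.γ * ν s ω) t) ∧
    (∀ i, ∀ᵐ ω ∂μ, ∀ t, v i t ω = v i ⊥ ω + (P t ω - P ⊥ ω) / (2 * p.lam) +
      timeIntegral (fun s => p.κ * p.ρ / (2 * p.lam) * Y s ω
        - p.κ * p.γ / (2 * p.lam) * ν s ω
        - p.φ / p.lam * X i s ω) t + (L i t ω - L i ⊥ ω)) ∧
    (∀ i, ∀ᵐ ω ∂μ, v i ⊤ ω = p.ϱ / p.lam * X i ⊤ ω - p.κ / (2 * p.lam) * Y ⊤ ω) ∧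
    (∀ᵐ z ∂(μ.prod (lebesgue T)),
      Tendsto (fun N : ℕ => (∑ i ∈ Finset.range N, v i z.2 z.1) / (N : ℝ)) atTop
        (𝓝 (ν z.2 z.1)))

end Systems

end PriceImpactGame

end

noncomputable section

namespace PriceImpactGame

/-! ### Pathwise calculus on `[0,T]` -/

section Paths

variable {T : ℝ}

/-! Integrate the equation of one player's speed from `t` to `T` and insert the terminal condition.
The equation for `Y` turns the terminal value and the drifts in `Y` and in the market average into a
multiple of `Y_t`, and the equation for `Z` can be solved explicitly. What results is `u_t = W_t +
R_t`. Here `R_t` consists of future increments of the martingales, so its conditional expectation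
given `ℱ t` is zero, and `|W_t|` is bounded pathwise by constants, `|P_T - P_t|` and the volumes
`∫₀ᵀ |u|`, `∫₀ᵀ |ν|` (`abs_speed_sub_le`). Since `u_t` is `ℱ t`-measurable, `u_t = E[W_t | ℱ t]`,
and the `L²` contraction of conditional expectation discards `R_t` without any estimate of the
martingales (`eLpNorm_le_eLpNorm_sub`, `eLpNorm_speed_le`).

This gives `‖u_t‖₂ ≤ B + θ j`, with `j` the `L²` norm of the volume, finite by admissibility.
Conversely `j ≤ T sup_t ‖u_t‖₂` by Cauchy–Schwarz in time (`eLpNorm_totalVolume_le`). The smallness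
condition yields `T θ ≤ 1/2` (`smallness`), so `j` is absorbed and `‖u_t‖₂ ≤ 2B`.

In the `N`-player game `j` is the largest volume norm among the players, which also dominates that
of the average; `B` and `θ` do not depend on `N`. In the mean field game `ν` is a single admissible
process shared by all players, so its finite volume norm goes into `B`. The price enters only
through a bound on `‖P_T - P_t‖₂` uniform in `t`, which follows from the `ℋ²` condition. -/

instance isFiniteMeasure_lebesgue : IsFiniteMeasure (lebesgue T) := by
  refine ⟨?_⟩
  rw [lebesgue, comap_subtype_coe_apply measurableSet_Icc]
  exact (measure_mono (Subtype.coe_image_subset _ _)).trans_lt (measure_Icc_lt_top (a := 0) (b := T))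

lemma lebesgue_univ : lebesgue T Set.univ = ENNReal.ofReal T := by
  rw [lebesgue, comap_subtype_coe_apply measurableSet_Icc, Set.image_univ, Subtype.range_coe,
    Real.volume_Icc, sub_zero]

/-- Extending `f` to the line by projection onto `[0,T]` makes calculus for interval integrals
available. -/
lemma timeIntegral_eq_intervalIntegral (hT : 0 ≤ T) (f : TimeInterval T → ℝ) (t : TimeInterval T) :
    timeIntegral f t = ∫ s in (0 : ℝ)..t, f (Set.projIcc 0 T hT s) := by
  have h1 : timeIntegral f t = ∫ s in Subtype.val ⁻¹' (Set.Iic (t : ℝ)),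
      f (Set.projIcc 0 T hT (s : ℝ)) ∂(lebesgue T) := by
    simp only [Set.projIcc_val]
    rfl
  have h2 : (lebesgue T).map Subtype.val = volume.restrict (Set.Icc 0 T) :=
    map_comap_subtype_coe measurableSet_Icc _
  rw [h1, ← (MeasurableEmbedding.subtype_coe (measurableSet_Icc (a := (0 : ℝ)) (b := T))).setIntegral_map
    (fun s => f (Set.projIcc 0 T hT s)), h2, Measure.restrict_restrict measurableSet_Iic,
    intervalIntegral.integral_of_le t.2.1, ← integral_Icc_eq_integral_Ioc]
  congr 2
  ext s
  simp only [Set.mem_inter_iff, Set.mem_Iic, Set.mem_Icc]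
  have := t.2.2
  constructor
  · rintro ⟨a, b, c⟩
    exact ⟨b, a⟩
  · rintro ⟨a, b⟩
    exact ⟨b, a, b.trans this⟩

lemma intervalIntegrable_projIcc (hT : 0 ≤ T) {f : TimeInterval T → ℝ}
    (hf : Integrable f (lebesgue T)) :
    IntervalIntegrable (fun s => f (Set.projIcc 0 T hT s)) volume 0 T := by
  rw [intervalIntegrable_iff_integrableOn_Icc_of_le hT, IntegrableOn,
    ← map_comap_subtype_coe measurableSet_Icc,
    (MeasurableEmbedding.subtype_coe (measurableSet_Icc (a := (0 : ℝ)) (b := T))).integrable_map_iff]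
  refine hf.congr (ae_of_all _ fun s => ?_)
  simp [Set.projIcc_val]

/-- Variation of constants for `dD = a D dt + g dt` on an interval of the real line. -/
lemma exp_mul_eq_of_intervalIntegral {F f g : ℝ → ℝ} {a b d : ℝ} (hb : 0 ≤ b)
    (hf : IntervalIntegrable f volume 0 b)
    (hF : ∀ t ∈ Set.Icc 0 b, F t = d + ∫ s in (0 : ℝ)..t, f s)
    (hfg : ∀ t ∈ Set.Icc 0 b, f t = a * F t + g t) :
    Real.exp (-a * b) * F b = d + ∫ s in (0 : ℝ)..b, Real.exp (-a * s) * g s := by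
  -- `F` is constrained only on `[0,b]`. Its primitive representation `G` is absolutely continuous,
  -- so the product rule holds in integrated form even though `f` is merely integrable.
  set G : ℝ → ℝ := fun t => d + ∫ s in (0 : ℝ)..t, f s with hG
  have hac : AbsolutelyContinuousOnInterval G 0 b := by
    have h0 : AbsolutelyContinuousOnInterval (fun _ : ℝ => d) 0 b :=
      contDiff_const.contDiffOn.absolutelyContinuousOnInterval
    exact h0.add (hf.absolutelyContinuousOnInterval_intervalIntegral (by simp))
  have hE : AbsolutelyContinuousOnInterval (fun t => Real.exp (-a * t)) 0 b := by
    apply ContDiffOn.absolutelyContinuousOnInterval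
    fun_prop
  have key := hE.integral_deriv_mul_eq_sub hac
  have hGF : ∀ t ∈ Set.Icc 0 b, G t = F t := fun t ht => (hF t ht).symm
  have hG0 : G 0 = d := by simp [hG]
  rw [hG0, hGF b ⟨hb, le_rfl⟩] at key
  simp only [mul_zero, Real.exp_zero, one_mul] at key
  have hint : ∫ x in (0 : ℝ)..b, deriv (fun t => Real.exp (-a * t)) x * G x
      + Real.exp (-a * x) * deriv G x = ∫ s in (0 : ℝ)..b, Real.exp (-a * s) * g s := by
    apply intervalIntegral.integral_congr_ae
    filter_upwards [hf.ae_hasDerivAt_integral] with s hs hs'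
    have hs1 : s ∈ Set.uIcc 0 b := Set.uIoc_subset_uIcc hs'
    have hs2 : s ∈ Set.Icc 0 b := by rwa [Set.uIcc_of_le hb] at hs1
    have hd : HasDerivAt G (f s) s := (hs hs1 0 (by simp)).const_add d
    have he : HasDerivAt (fun t => Real.exp (-a * t)) (Real.exp (-a * s) * (-a)) s := by
      simpa using ((hasDerivAt_id s).const_mul (-a)).exp
    rw [hd.deriv, he.deriv, hGF s hs2, hfg s hs2]
    ring
  rw [hint] at key
  linarith

/-- Variation of constants for `dD = a D dt + g dt` on `[0,T]`. -/
lemma exp_mul_eq_of_timeIntegral (hT : 0 ≤ T) {D g : TimeInterval T → ℝ} {a d : ℝ}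
    (hD : Integrable D (lebesgue T)) (hg : Integrable g (lebesgue T))
    (h : ∀ t, D t = d + timeIntegral (fun s => a * D s + g s) t) (t : TimeInterval T) :
    Real.exp (-a * t) * D t = d + timeIntegral (fun s => Real.exp (-a * s) * g s) t := by
  have hf : Integrable (fun s => a * D s + g s) (lebesgue T) := (hD.const_mul a).add hg
  have hi := intervalIntegrable_projIcc hT hf
  have ht := t.2
  have key := exp_mul_eq_of_intervalIntegral (F := fun s => D (Set.projIcc 0 T hT s))
    (f := fun s => a * D (Set.projIcc 0 T hT s) + g (Set.projIcc 0 T hT s))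
    (g := fun s => g (Set.projIcc 0 T hT s)) (a := a) (b := t) (d := d) ht.1
    (hi.mono_set (by
      rw [Set.uIcc_of_le hT, Set.uIcc_of_le ht.1]; exact Set.Icc_subset_Icc le_rfl ht.2))
    (fun s hs => by
      have hs' : s ∈ Set.Icc 0 T := ⟨hs.1, hs.2.trans ht.2⟩
      simp only [Set.projIcc_of_mem hT hs']
      rw [h, timeIntegral_eq_intervalIntegral hT])
    (fun _ _ => rfl)
  simp only [Set.projIcc_val] at key
  rw [key, timeIntegral_eq_intervalIntegral hT]
  congr 1
  apply intervalIntegral.integral_congr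
  intro s hs
  rw [Set.uIcc_of_le ht.1] at hs
  have hs' : s ∈ Set.Icc 0 T := ⟨hs.1, hs.2.trans ht.2⟩
  simp only [Set.projIcc_of_mem hT hs']

lemma timeIntegral_top_sub [Fact (0 < T)] {f : TimeInterval T → ℝ}
    (hf : Integrable f (lebesgue T)) (t : TimeInterval T) :
    timeIntegral f ⊤ - timeIntegral f t = ∫ s in Set.Ioi t, f s ∂(lebesgue T) := by
  have h : ∫ s in Set.Iic t ∪ Set.Ioi t, f s ∂(lebesgue T) =
      (∫ s in Set.Iic t, f s ∂(lebesgue T)) + ∫ s in Set.Ioi t, f s ∂(lebesgue T) :=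
    setIntegral_union (Set.Iic_disjoint_Ioi (le_refl t))
      measurableSet_Ioi hf.integrableOn hf.integrableOn
  rw [Set.Iic_union_Ioi] at h
  simp only [timeIntegral, Set.Iic_top]
  rw [h]
  ring

lemma abs_setIntegral_mul_le {f w : TimeInterval T → ℝ} (hf : Integrable f (lebesgue T))
    {S : Set (TimeInterval T)} (hS : MeasurableSet S) {J : ℝ}
    (hJ : ∫ s, |f s| ∂(lebesgue T) ≤ J) (hw : ∀ s ∈ S, |w s| ≤ 1) :
    |∫ s in S, w s * f s ∂(lebesgue T)| ≤ J := by
  refine le_trans ?_ hJ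
  calc |∫ s in S, w s * f s ∂(lebesgue T)| ≤ ∫ s in S, |f s| ∂(lebesgue T) := by
        rw [← Real.norm_eq_abs]
        refine norm_integral_le_of_norm_le hf.abs.integrableOn ?_
        filter_upwards [ae_restrict_mem hS] with s hs
        rw [Real.norm_eq_abs, abs_mul]
        exact mul_le_of_le_one_left (abs_nonneg _) (hw s hs)
    _ ≤ ∫ s, |f s| ∂(lebesgue T) :=
        setIntegral_le_integral hf.abs (ae_of_all _ fun _ => abs_nonneg _)

/-! ### Càdlàg functions and processes -/

/-- The one-sided limits bound `f` near each point; compactness makes the bound global. -/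
lemma IsCadlag.exists_bound {f : TimeInterval T → ℝ} (hf : IsCadlag f) : ∃ C, ∀ t, |f t| ≤ C := by
  have h : ∃ C, ∀ t ∈ (Set.univ : Set (TimeInterval T)), |f t| ≤ C := by
    refine isCompact_univ.induction_on (p := fun s => ∃ C, ∀ t ∈ s, |f t| ≤ C) ⟨0, by simp⟩ ?_ ?_ ?_
    · rintro s t hst ⟨C, hC⟩
      exact ⟨C, fun x hx => hC x (hst hx)⟩
    · rintro s t ⟨C, hC⟩ ⟨D, hD⟩
      refine ⟨max C D, fun x hx => hx.elim (fun h => (hC x h).trans (le_max_left _ _))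
        (fun h => (hD x h).trans (le_max_right _ _))⟩
    · intro t _
      obtain ⟨hr, l, hl⟩ := hf t
      have h1 : ∀ᶠ s in 𝓝[≥] t, |f s| < |f t| + 1 :=
        (hr.tendsto.abs).eventually_lt_const (by linarith)
      have h2 : ∀ᶠ s in 𝓝[<] t, |f s| < |l| + 1 := hl.abs.eventually_lt_const (by linarith)
      refine ⟨{s | |f s| ≤ max (|f t| + 1) (|l| + 1)}, ?_, _, fun _ h => h⟩
      rw [nhdsWithin_univ, ← nhdsLT_sup_nhdsGE]
      refine Filter.mem_sup.2 ⟨?_, ?_⟩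
      · filter_upwards [h2] with s hs using hs.le.trans (le_max_right _ _)
      · filter_upwards [h1] with s hs using hs.le.trans (le_max_left _ _)
  obtain ⟨C, hC⟩ := h
  exact ⟨C, fun t => hC t trivial⟩

/-- The right endpoint, at most `T`, of the cell of the grid `ℤ / (n + 1)` containing `t`. -/
def gridSucc (hT : 0 ≤ T) (n : ℕ) (t : TimeInterval T) : TimeInterval T :=
  Set.projIcc 0 T hT ((⌊(t : ℝ) * (n + 1)⌋ + 1 : ℤ) / (n + 1 : ℝ))

lemma tendsto_gridSucc (hT : 0 ≤ T) (t : TimeInterval T) :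
    Tendsto (fun n => gridSucc hT n t) atTop (𝓝[≥] t) := by
  have hle : ∀ n : ℕ, (t : ℝ) ≤ (⌊(t : ℝ) * (n + 1)⌋ + 1 : ℤ) / (n + 1 : ℝ) := fun n => by
    rw [le_div_iff₀ (by positivity)]
    push_cast
    exact (Int.lt_floor_add_one _).le
  have hub : ∀ n : ℕ, (⌊(t : ℝ) * (n + 1)⌋ + 1 : ℤ) / (n + 1 : ℝ) ≤ (t : ℝ) + 1 / (n + 1 : ℝ) :=
    fun n => by
    rw [div_le_iff₀ (by positivity), add_mul, one_div, inv_mul_cancel₀ (by positivity)]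
    push_cast
    linarith [Int.floor_le ((t : ℝ) * (n + 1))]
  refine tendsto_nhdsWithin_iff.2 ⟨?_, Eventually.of_forall fun n => ?_⟩
  · have h : Tendsto (fun n : ℕ => ((⌊(t : ℝ) * (n + 1)⌋ + 1 : ℤ) / (n + 1 : ℝ) : ℝ)) atTop
        (𝓝 (t : ℝ)) := by
      refine tendsto_of_tendsto_of_tendsto_of_le_of_le tendsto_const_nhds ?_ hle hub
      simpa using tendsto_const_nhds.add (tendsto_one_div_add_atTop_nhds_zero_nat (𝕜 := ℝ))
    have h' := (continuous_projIcc (h := hT)).continuousAt.tendsto.comp h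
    rwa [Set.projIcc_val] at h'
  · have := Set.monotone_projIcc hT (hle n)
    rwa [Set.projIcc_val] at this

/-- Sampling at `gridSucc` depends on time only through an integer, hence is jointly measurable. The
sampled times approach `t` from the right, so right continuity gives pointwise convergence. -/
lemma measurable_uncurry_of_isCadlag {Ω : Type*} [MeasurableSpace Ω] (hT : 0 ≤ T)
    {X : TimeInterval T → Ω → ℝ} (hX : ∀ t, Measurable (X t))
    (hc : ∀ ω, IsCadlag (fun t => X t ω)) :
    Measurable (fun z : Ω × TimeInterval T => X z.2 z.1) := by
  refine measurable_of_tendsto_metrizable (f := fun (n : ℕ) (z : Ω × TimeInterval T) =>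
    X (gridSucc hT n z.2) z.1) (fun n => ?_) ?_
  · let F : Ω × ℤ → ℝ := fun q => X (Set.projIcc 0 T hT ((q.2 + 1 : ℤ) / (n + 1 : ℝ))) q.1
    let G : Ω × TimeInterval T → Ω × ℤ := fun z => (z.1, ⌊(z.2 : ℝ) * (n + 1)⌋)
    have hF : Measurable F := measurable_from_prod_countable_left fun k =>
      hX (Set.projIcc 0 T hT ((k + 1 : ℤ) / (n + 1 : ℝ)))
    have hG : Measurable G := measurable_fst.prodMk
      (((measurable_subtype_coe.comp measurable_snd).mul_const _).floor)
    have hFG : (fun z : Ω × TimeInterval T => X (gridSucc hT n z.2) z.1) = F ∘ G := rfl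
    rw [hFG]
    exact hF.comp hG
  · rw [tendsto_pi_nhds]
    intro z
    have h : Tendsto (fun t => X t z.1) (𝓝[≥] z.2) (𝓝 (X z.2 z.1)) := (hc z.1 z.2).1
    exact h.comp (tendsto_gridSucc hT z.2)

lemma IsCadlag.measurable (hT : 0 ≤ T) {f : TimeInterval T → ℝ} (hf : IsCadlag f) :
    Measurable f :=
  (measurable_uncurry_of_isCadlag (Ω := Unit) (X := fun t _ => f t) hT
    (fun _ => measurable_const) (fun _ => hf)).comp (measurable_const (a := ()) |>.prodMk measurable_id)

lemma IsCadlag.integrable (hT : 0 ≤ T) {f : TimeInterval T → ℝ} (hf : IsCadlag f) :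
    Integrable f (lebesgue T) := by
  obtain ⟨C, hC⟩ := hf.exists_bound
  exact Integrable.of_bound (hf.measurable hT).aestronglyMeasurable C (ae_of_all _ hC)

/-! ### The decoupled equation for one player -/

/-- Along a path of the forward backward system, the trading speed `u t` is a martingale increment
plus a remainder controlled by the time integrals of the speeds. -/
lemma abs_speed_sub_le [Fact (0 < T)] {lam γ κ ρ ϱ φ y c x : ℝ} (hlam : 0 < lam) (hγ : 0 < γ)
    (hκ : 0 < κ) (hρ : 0 < ρ) (hϱ : 0 < ϱ) (hφ : 0 < φ) (hy : 0 < y) (hc : 0 ≤ c)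
    {u ν X Y Z K M P : TimeInterval T → ℝ} (hu : Integrable u (lebesgue T))
    (hν : Integrable ν (lebesgue T)) (hX : IsCadlag X) (hY : IsCadlag Y) (hZ : IsCadlag Z)
    (hK : IsCadlag K) (eX : ∀ t, X t = x - timeIntegral u t)
    (eY : ∀ t, Y t = y + timeIntegral (fun s => -ρ * Y s + γ * ν s) t)
    (eu : ∀ t, u t = u ⊥ + (P t - P ⊥) / (2 * lam) +
      timeIntegral (fun s => κ * ρ / (2 * lam) * Y s - κ * γ / (2 * lam) * ν s
        + c / (2 * lam) * u s - φ / lam * X s + ρ / (2 * lam) * Z s) t + (M t - M ⊥))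
    (uT : u ⊤ = ϱ / lam * X ⊤ - κ / (2 * lam) * Y ⊤)
    (eZ : ∀ t, Z t = Z ⊥ + timeIntegral (fun s => ρ * Z s + c * u s) t + (K t - K ⊥))
    (ZT : Z ⊤ = 0) (t : TimeInterval T) :
    |u t - (ρ / (2 * lam) *
        (∫ s in Set.Ioi t, Real.exp (-ρ * (s - t)) * (K ⊤ - K s) ∂(lebesgue T)) - (M ⊤ - M t))|
      ≤ (ϱ / lam + φ / lam * T) * (|x| + ∫ s, |u s| ∂(lebesgue T))
        + κ / (2 * lam) * (y + γ * ∫ s, |ν s| ∂(lebesgue T)) + 1 / (2 * lam) * |P ⊤ - P t|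
        + c / (2 * lam) * ∫ s, |u s| ∂(lebesgue T) := by
  have hT : 0 < T := Fact.out
  have iX := hX.integrable hT.le
  have iY := hY.integrable hT.le
  have iZ := hZ.integrable hT.le
  have iK := hK.integrable hT.le
  have hexp : ∀ a : ℝ, Measurable (fun s : TimeInterval T => Real.exp (a * (s - t))) := by
    intro a; fun_prop
  have iE : ∀ (a : ℝ) {f : TimeInterval T → ℝ}, Integrable f (lebesgue T) →
      Integrable (fun s : TimeInterval T => Real.exp (a * (s - t)) * f s) (lebesgue T) := by
    intro a f hf
    obtain ⟨C, hC⟩ := isCompact_univ.exists_bound_of_continuousOn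
      (f := fun s : TimeInterval T => Real.exp (a * (s - t))) (by fun_prop)
    exact hf.bdd_mul (hexp a).aestronglyMeasurable (ae_of_all _ fun s => hC s trivial)
  have iE' : ∀ (a : ℝ) {f : TimeInterval T → ℝ}, Integrable f (lebesgue T) →
      Integrable (fun s : TimeInterval T => Real.exp (a * s) * f s) (lebesgue T) := by
    intro a f hf
    have := (iE a hf).const_mul (Real.exp (a * t))
    refine this.congr (ae_of_all _ fun s => ?_)
    simp only
    rw [← mul_assoc, ← Real.exp_add]
    ring_nf
  set J := ∫ s, |u s| ∂(lebesgue T) with hJ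
  set Jν := ∫ s, |ν s| ∂(lebesgue T) with hJν
  -- tails of the equations
  have tY : Y ⊤ - Y t = -ρ * (∫ s in Set.Ioi t, Y s ∂(lebesgue T))
      + γ * ∫ s in Set.Ioi t, ν s ∂(lebesgue T) := by
    have h := timeIntegral_top_sub ((iY.const_mul (-ρ)).add (hν.const_mul γ)) t
    simp only [Pi.add_apply] at h
    rw [integral_add (iY.const_mul _).integrableOn (hν.const_mul _).integrableOn,
      integral_const_mul, integral_const_mul] at h
    rw [← h, eY ⊤, eY t]
    change _ = timeIntegral (fun s => -ρ * Y s + γ * ν s) ⊤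
      - timeIntegral (fun s => -ρ * Y s + γ * ν s) t
    ring
  have tZ : Z ⊤ - Z t = ρ * (∫ s in Set.Ioi t, Z s ∂(lebesgue T))
      + c * (∫ s in Set.Ioi t, u s ∂(lebesgue T)) + (K ⊤ - K t) := by
    have h := timeIntegral_top_sub ((iZ.const_mul ρ).add (hu.const_mul c)) t
    simp only [Pi.add_apply] at h
    rw [integral_add (iZ.const_mul _).integrableOn (hu.const_mul _).integrableOn,
      integral_const_mul, integral_const_mul] at h
    rw [← h, eZ ⊤, eZ t]
    change _ = timeIntegral (fun s => ρ * Z s + c * u s) ⊤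
      - timeIntegral (fun s => ρ * Z s + c * u s) t + (K ⊤ - K t)
    ring
  have tu : u ⊤ - u t = (P ⊤ - P t) / (2 * lam)
      + (κ * ρ / (2 * lam) * (∫ s in Set.Ioi t, Y s ∂(lebesgue T))
        - κ * γ / (2 * lam) * (∫ s in Set.Ioi t, ν s ∂(lebesgue T))
        + c / (2 * lam) * (∫ s in Set.Ioi t, u s ∂(lebesgue T))
        - φ / lam * (∫ s in Set.Ioi t, X s ∂(lebesgue T))
        + ρ / (2 * lam) * (∫ s in Set.Ioi t, Z s ∂(lebesgue T))) + (M ⊤ - M t) := by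
    have i1 := iY.const_mul (κ * ρ / (2 * lam))
    have i2 := hν.const_mul (κ * γ / (2 * lam))
    have i3 := hu.const_mul (c / (2 * lam))
    have i4 := iX.const_mul (φ / lam)
    have i5 := iZ.const_mul (ρ / (2 * lam))
    have h := timeIntegral_top_sub ((((i1.sub i2).add i3).sub i4).add i5) t
    have e : (∫ s in Set.Ioi t, ((((fun s => κ * ρ / (2 * lam) * Y s)
          - fun s => κ * γ / (2 * lam) * ν s) + fun s => c / (2 * lam) * u s)
          - (fun s => φ / lam * X s) + fun s => ρ / (2 * lam) * Z s) s ∂(lebesgue T))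
        = κ * ρ / (2 * lam) * (∫ s in Set.Ioi t, Y s ∂(lebesgue T))
        - κ * γ / (2 * lam) * (∫ s in Set.Ioi t, ν s ∂(lebesgue T))
        + c / (2 * lam) * (∫ s in Set.Ioi t, u s ∂(lebesgue T))
        - φ / lam * (∫ s in Set.Ioi t, X s ∂(lebesgue T))
        + ρ / (2 * lam) * (∫ s in Set.Ioi t, Z s ∂(lebesgue T)) := by
      rw [integral_add' (((i1.sub i2).add i3).sub i4).integrableOn i5.integrableOn,
        integral_sub' ((i1.sub i2).add i3).integrableOn i4.integrableOn,
        integral_add' (i1.sub i2).integrableOn i3.integrableOn,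
        integral_sub' i1.integrableOn i2.integrableOn]
      simp only [integral_const_mul]
    rw [← e, ← h, eu ⊤, eu t]
    change _ = (P ⊤ - P t) / (2 * lam) + (timeIntegral (fun s => κ * ρ / (2 * lam) * Y s
        - κ * γ / (2 * lam) * ν s + c / (2 * lam) * u s - φ / lam * X s
        + ρ / (2 * lam) * Z s) ⊤ - timeIntegral (fun s => κ * ρ / (2 * lam) * Y s
        - κ * γ / (2 * lam) * ν s + c / (2 * lam) * u s - φ / lam * X s
        + ρ / (2 * lam) * Z s) t) + (M ⊤ - M t)
    ring
  -- explicit solution of the equation for `Z`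
  have iKK : Integrable (fun s => K ⊤ - K s) (lebesgue T) := (integrable_const _).sub iK
  have hZt : Z t + (K ⊤ - K t) = ρ * (∫ s in Set.Ioi t, Real.exp (-ρ * (s - t)) * (K ⊤ - K s)
      ∂(lebesgue T)) - c * ∫ s in Set.Ioi t, Real.exp (-ρ * (s - t)) * u s ∂(lebesgue T) := by
    have ig : Integrable (fun s => -(ρ * (K ⊤ - K s)) + c * u s) (lebesgue T) :=
      (iKK.const_mul ρ).neg.add (hu.const_mul c)
    -- Adding `K ⊤ - K s` removes the martingale part: the sum solves a pathwise linear equation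
    -- with terminal value `0`, and no stochastic integral is needed.
    have h := exp_mul_eq_of_timeIntegral hT.le (D := fun s => Z s + (K ⊤ - K s))
      (g := fun s => -(ρ * (K ⊤ - K s)) + c * u s) (a := ρ) (d := Z ⊥ + (K ⊤ - K ⊥))
      (iZ.add iKK) ig (fun s => by
        rw [eZ s]
        have : (fun s => ρ * (Z s + (K ⊤ - K s)) + (-(ρ * (K ⊤ - K s)) + c * u s))
            = fun s => ρ * Z s + c * u s := by ext; ring
        rw [this]; ring)
    have h1 := h ⊤
    have h2 := h t
    have h3 := timeIntegral_top_sub (iE' (-ρ) ig) t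
    have h4 : (∫ s in Set.Ioi t, Real.exp (-ρ * s) * (-(ρ * (K ⊤ - K s)) + c * u s) ∂(lebesgue T))
        = Real.exp (-ρ * t) * (-ρ * (∫ s in Set.Ioi t, Real.exp (-ρ * (s - t)) * (K ⊤ - K s)
          ∂(lebesgue T))
          + c * ∫ s in Set.Ioi t, Real.exp (-ρ * (s - t)) * u s ∂(lebesgue T)) := by
      rw [← integral_const_mul, ← integral_const_mul, ← integral_add
        ((iE (-ρ) iKK).const_mul _).integrableOn ((iE (-ρ) hu).const_mul _).integrableOn,
        ← integral_const_mul]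
      congr 1
      ext s
      have : Real.exp (-ρ * s) = Real.exp (-ρ * t) * Real.exp (-ρ * (s - t)) := by
        rw [← Real.exp_add]; ring_nf
      rw [this]; ring
    rw [h4] at h3
    rw [ZT] at h1
    have h5 : Real.exp (-ρ * t) * (Z t + (K ⊤ - K t)) = Real.exp (-ρ * t) *
        (ρ * (∫ s in Set.Ioi t, Real.exp (-ρ * (s - t)) * (K ⊤ - K s) ∂(lebesgue T))
          - c * ∫ s in Set.Ioi t, Real.exp (-ρ * (s - t)) * u s ∂(lebesgue T)) := by
      linear_combination h2 - h1 - h3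
    exact mul_left_cancel₀ (Real.exp_pos _).ne' h5
  -- bounds
  have bX : ∀ s, |X s| ≤ |x| + J := fun s => by
    rw [eX s]
    refine (abs_sub _ _).trans (add_le_add le_rfl ?_)
    have := abs_setIntegral_mul_le (w := fun _ => 1) hu (measurableSet_Iic (a := s)) hJ.ge (by simp)
    simpa [timeIntegral] using this
  have bXt : |∫ s in Set.Ioi t, X s ∂(lebesgue T)| ≤ T * (|x| + J) := by
    have hJ0 : 0 ≤ |x| + J := (abs_nonneg _).trans (bX t)
    have h := norm_setIntegral_le_of_norm_le_const (μ := lebesgue T) (s := Set.Ioi t)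
      (f := X) (C := |x| + J) (measure_lt_top _ _) (fun s _ => bX s)
    refine h.trans ?_
    rw [mul_comm]
    refine mul_le_mul_of_nonneg_right ?_ hJ0
    have := measureReal_mono (μ := lebesgue T) (Set.subset_univ (Set.Ioi t))
    rwa [measureReal_def (s := Set.univ), lebesgue_univ, ENNReal.toReal_ofReal hT.le] at this
  have bY : |Y t| ≤ y + γ * Jν := by
    -- The explicit solution has kernel `exp (-ρ (t - s)) ≤ 1`, so the bound on `Y` carries no
    -- exponential constant in `ρ T`.
    have h := exp_mul_eq_of_timeIntegral hT.le (D := Y) (g := fun s => γ * ν s) (a := -ρ) (d := y)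
      iY (hν.const_mul γ) eY t
    have h1 : timeIntegral (fun s => Real.exp (-(-ρ) * s) * (γ * ν s)) t = Real.exp (ρ * t) *
        (γ * ∫ s in Set.Iic t, Real.exp (ρ * (s - t)) * ν s ∂(lebesgue T)) := by
      rw [timeIntegral, ← integral_const_mul, ← integral_const_mul]
      congr 1
      ext s
      have : Real.exp (-(-ρ) * s) = Real.exp (ρ * t) * Real.exp (ρ * (s - t)) := by
        rw [← Real.exp_add]; ring_nf
      rw [this]; ring
    have h2 : Y t = Real.exp (-ρ * t) * y
        + γ * ∫ s in Set.Iic t, Real.exp (ρ * (s - t)) * ν s ∂(lebesgue T) := by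
      rw [h1, neg_neg] at h
      have e : Real.exp (-ρ * t) * Real.exp (ρ * t) = 1 := by
        rw [← Real.exp_add]; simp
      linear_combination Real.exp (-ρ * t) * h - (Y t - γ * ∫ s in Set.Iic t,
        Real.exp (ρ * (s - t)) * ν s ∂(lebesgue T)) * e
    rw [h2]
    refine (abs_add_le _ _).trans (add_le_add ?_ ?_)
    · rw [abs_mul, abs_of_pos (Real.exp_pos _), abs_of_pos hy]
      refine mul_le_of_le_one_left hy.le (Real.exp_le_one_iff.2 ?_)
      have := t.2.1
      nlinarith
    · rw [abs_mul, abs_of_pos hγ]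
      refine mul_le_mul_of_nonneg_left ?_ hγ.le
      refine abs_setIntegral_mul_le hν measurableSet_Iic hJν.ge fun s hs => ?_
      rw [abs_of_pos (Real.exp_pos _)]
      refine Real.exp_le_one_iff.2 (mul_nonpos_of_nonneg_of_nonpos hρ.le ?_)
      exact sub_nonpos.2 hs
  have bu : |∫ s in Set.Ioi t, Real.exp (-ρ * (s - t)) * u s ∂(lebesgue T)| ≤ J := by
    refine abs_setIntegral_mul_le hu measurableSet_Ioi hJ.ge fun s hs => ?_
    rw [abs_of_pos (Real.exp_pos _)]
    refine Real.exp_le_one_iff.2 (mul_nonpos_of_nonpos_of_nonneg (by linarith) ?_)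
    exact sub_nonneg.2 (le_of_lt hs)
  -- conclusion
  have key : u t - (ρ / (2 * lam) *
        (∫ s in Set.Ioi t, Real.exp (-ρ * (s - t)) * (K ⊤ - K s) ∂(lebesgue T)) - (M ⊤ - M t))
      = (ϱ / lam * X ⊤ + φ / lam * ∫ s in Set.Ioi t, X s ∂(lebesgue T))
        + -(κ / (2 * lam) * Y t) + -(1 / (2 * lam) * (P ⊤ - P t))
        + -(c / (2 * lam) * ∫ s in Set.Ioi t, Real.exp (-ρ * (s - t)) * u s ∂(lebesgue T)) := by
    rw [ZT] at tZ
    rw [uT] at tu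
    generalize (∫ s in Set.Ioi t, Real.exp (-ρ * (s - t)) * (K ⊤ - K s) ∂(lebesgue T)) = I₁ at *
    generalize (∫ s in Set.Ioi t, Real.exp (-ρ * (s - t)) * u s ∂(lebesgue T)) = I₂ at *
    field_simp at tu ⊢
    -- `tY` collapses `Y ⊤` and the drifts in `Y` and `ν` to `Y t`; `tZ` replaces the drifts in `Z`
    -- and `u` by `Z t + (K ⊤ - K t)`, which `hZt` evaluates.
    linear_combination -tu + hZt + tZ - κ * tY
  rw [key]
  refine (abs_add_le _ _).trans (add_le_add ((abs_add_le _ _).trans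
    (add_le_add ((abs_add_le _ _).trans (add_le_add ?_ ?_)) ?_)) ?_)
  · refine (abs_add_le _ _).trans ?_
    rw [abs_mul, abs_mul, abs_of_pos (div_pos hϱ hlam), abs_of_pos (div_pos hφ hlam), add_mul]
    refine add_le_add (mul_le_mul_of_nonneg_left (bX _) (div_pos hϱ hlam).le) ?_
    rw [mul_assoc]
    exact mul_le_mul_of_nonneg_left bXt (div_pos hφ hlam).le
  · rw [abs_neg, abs_mul, abs_of_pos (by positivity)]
    exact mul_le_mul_of_nonneg_left bY (by positivity)
  · rw [abs_neg, abs_mul, abs_of_pos (by positivity)]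
  · rw [abs_neg, abs_mul, abs_of_nonneg (by positivity)]
    exact mul_le_mul_of_nonneg_left bu (by positivity)

end Paths

/-! ### Second moments and traded volumes -/

section Moments

lemma eLpNorm_two_sq {α : Type*} [MeasurableSpace α] (μ : Measure α) (f : α → ℝ) :
    eLpNorm f 2 μ ^ 2 = ∫⁻ a, ‖f a‖ₑ ^ 2 ∂μ := by
  have h := eLpNorm_nnreal_pow_eq_lintegral (μ := μ) (f := f) (p := 2) (by norm_num)
  simpa using h

lemma eLpNorm_two_sq_eq_ofReal {α : Type*} [MeasurableSpace α] (μ : Measure α) (f : α → ℝ) :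
    eLpNorm f 2 μ ^ 2 = ∫⁻ a, ENNReal.ofReal (f a ^ 2) ∂μ := by
  rw [eLpNorm_two_sq]
  refine lintegral_congr fun a => ?_
  rw [← sq_abs, ENNReal.ofReal_pow (abs_nonneg _), ← Real.norm_eq_abs, ofReal_norm]

lemma lintegral_sq_le {α : Type*} [MeasurableSpace α] (μ : Measure α) [IsFiniteMeasure μ]
    {f : α → ℝ} (hf : AEStronglyMeasurable f μ) :
    (∫⁻ a, ‖f a‖ₑ ∂μ) ^ 2 ≤ μ Set.univ * ∫⁻ a, ‖f a‖ₑ ^ 2 ∂μ := by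
  have h := eLpNorm_le_eLpNorm_mul_rpow_measure_univ (p := 1) (q := 2) (by norm_num) hf
  rw [← eLpNorm_one_eq_lintegral_enorm, ← eLpNorm_two_sq]
  refine (pow_le_pow_left₀ (zero_le) h 2).trans ?_
  rw [mul_pow, mul_comm, ← ENNReal.rpow_natCast (_ ^ _), ← ENNReal.rpow_mul]
  norm_num

variable {Ω : Type*} {mΩ : MeasurableSpace Ω} {μ : Measure Ω} {T : ℝ}

lemma eLpNorm_add_le_ofReal {f g : Ω → ℝ} {a b : ℝ} (hf : AEStronglyMeasurable f μ)
    (hg : AEStronglyMeasurable g μ) (ha : 0 ≤ a) (hb : 0 ≤ b)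
    (hfa : eLpNorm f 2 μ ≤ ENNReal.ofReal a) (hgb : eLpNorm g 2 μ ≤ ENNReal.ofReal b) :
    eLpNorm (fun ω => f ω + g ω) 2 μ ≤ ENNReal.ofReal (a + b) := by
  rw [ENNReal.ofReal_add ha hb]
  exact (eLpNorm_add_le hf hg (by norm_num)).trans (add_le_add hfa hgb)

lemma eLpNorm_const_mul_le_ofReal {f : Ω → ℝ} {a c : ℝ} (hc : 0 ≤ c)
    (hfa : eLpNorm f 2 μ ≤ ENNReal.ofReal a) :
    eLpNorm (fun ω => c * f ω) 2 μ ≤ ENNReal.ofReal (c * a) := by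
  rw [ENNReal.ofReal_mul hc]
  have h := eLpNorm_const_smul (p := 2) (μ := μ) c f
  have h' : (c • f) = fun ω => c * f ω := by ext; simp
  rw [← h', h, Real.enorm_eq_ofReal hc]
  gcongr

lemma eLpNorm_const_le_ofReal [IsProbabilityMeasure μ] {c : ℝ} (hc : 0 ≤ c) :
    eLpNorm (fun _ : Ω => c) 2 μ ≤ ENNReal.ofReal c := by
  rw [eLpNorm_const _ (by norm_num) (IsProbabilityMeasure.ne_zero μ)]
  simp [Real.enorm_eq_ofReal hc]

/-- The time integral `∫₀ᵀ |f(ω, t)| dt`. -/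
def totalVolume (f : TimeInterval T → Ω → ℝ) (ω : Ω) : ℝ := ∫ t, |f t ω| ∂(lebesgue T)

lemma aestronglyMeasurable_totalVolume [SFinite μ] {f : TimeInterval T → Ω → ℝ}
    (hf : AEStronglyMeasurable (fun z : Ω × TimeInterval T => f z.2 z.1) (μ.prod (lebesgue T))) :
    AEStronglyMeasurable (totalVolume f) μ := by
  have h := hf.norm.integral_prod_right'
  exact h

lemma eLpNorm_totalVolume_sq_le [IsProbabilityMeasure μ] {f : TimeInterval T → Ω → ℝ}
    (hf : AEStronglyMeasurable (fun z : Ω × TimeInterval T => f z.2 z.1) (μ.prod (lebesgue T))) :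
    eLpNorm (totalVolume f) 2 μ ^ 2 ≤
      ENNReal.ofReal T * ∫⁻ z, ‖f z.2 z.1‖ₑ ^ 2 ∂(μ.prod (lebesgue T)) := by
  rw [eLpNorm_two_sq, lintegral_prod _ (hf.enorm.pow_const 2), ← lintegral_const_mul'' _
    (AEMeasurable.lintegral_prod_right' (f := fun z : Ω × TimeInterval T => ‖f z.2 z.1‖ₑ ^ 2)
      (hf.enorm.pow_const 2))]
  refine lintegral_mono_ae ?_
  filter_upwards [hf.prodMk_left] with ω hω
  have h1 : ‖totalVolume f ω‖ₑ ≤ ∫⁻ t, ‖f t ω‖ₑ ∂(lebesgue T) := by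
    refine (enorm_integral_le_lintegral_enorm _).trans_eq ?_
    simp [← Real.norm_eq_abs]
  refine (pow_le_pow_left₀ (zero_le) h1 2).trans ?_
  have h2 := lintegral_sq_le (lebesgue T) hω
  rwa [lebesgue_univ] at h2

/-- This a priori finiteness is what permits the volume norm to be absorbed later. -/
lemma eLpNorm_totalVolume_lt_top [IsProbabilityMeasure μ] {f : TimeInterval T → Ω → ℝ}
    (hf : MemLp (fun z : Ω × TimeInterval T => f z.2 z.1) 2 (μ.prod (lebesgue T))) :
    eLpNorm (totalVolume f) 2 μ < ∞ := by
  have h := eLpNorm_totalVolume_sq_le hf.1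
  rw [← eLpNorm_two_sq (μ.prod (lebesgue T)) (fun z => f z.2 z.1)] at h
  have h' : eLpNorm (totalVolume f) 2 μ ^ 2 < ∞ :=
    h.trans_lt (ENNReal.mul_lt_top ENNReal.ofReal_lt_top (ENNReal.pow_lt_top hf.2))
  by_contra hc
  rw [not_lt, top_le_iff] at hc
  simp [hc] at h'

/-- Cauchy–Schwarz in time and Tonelli each contribute a factor `T` to the square. The resulting
factor `T` is the gain that closes the estimate on a short horizon. -/
lemma eLpNorm_totalVolume_le [IsProbabilityMeasure μ] (hT : 0 ≤ T) {f : TimeInterval T → Ω → ℝ}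
    (hf : AEStronglyMeasurable (fun z : Ω × TimeInterval T => f z.2 z.1) (μ.prod (lebesgue T)))
    {C : ℝ} (hC : ∀ t, eLpNorm (f t) 2 μ ≤ ENNReal.ofReal C) :
    eLpNorm (totalVolume f) 2 μ ≤ ENNReal.ofReal (T * C) := by
  have h := eLpNorm_totalVolume_sq_le hf
  rw [lintegral_prod_symm _ (hf.enorm.pow_const 2)] at h
  have h1 : ∫⁻ t, ∫⁻ ω, ‖f t ω‖ₑ ^ 2 ∂μ ∂(lebesgue T) ≤
      ENNReal.ofReal C ^ 2 * ENNReal.ofReal T := by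
    rw [← lebesgue_univ (T := T), ← lintegral_const]
    refine lintegral_mono fun t => ?_
    rw [← eLpNorm_two_sq]
    exact pow_le_pow_left₀ (zero_le) (hC t) 2
  have h2 : eLpNorm (totalVolume f) 2 μ ^ 2 ≤ ENNReal.ofReal (T * C) ^ 2 := by
    refine h.trans ((mul_le_mul_right h1 _).trans_eq ?_)
    rw [ENNReal.ofReal_mul hT]
    ring
  exact (ENNReal.pow_le_pow_left_iff two_ne_zero).1 h2

lemma Admissible.memLp [Fact (0 < T)] [SFinite μ] {ℱ : Filtration (TimeInterval T) mΩ}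
    {v : TimeInterval T → Ω → ℝ} (hv : Admissible ℱ μ v) :
    MemLp (fun z : Ω × TimeInterval T => v z.2 z.1) 2 (μ.prod (lebesgue T)) := by
  have hm : Measurable (fun z : Ω × TimeInterval T => v z.2 z.1) := by
    -- Progressive measurability at the terminal time is joint measurability on all of `[0,T]`.
    have h1 : Measurable[Subtype.instMeasurableSpace.prod (ℱ ⊤)]
        fun p : Set.Iic (⊤ : TimeInterval T) × Ω => v p.1 p.2 := (hv.progressive ⊤).measurable
    have h2 : Measurable (fun p : Set.Iic (⊤ : TimeInterval T) × Ω => v p.1 p.2) :=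
      h1.mono (sup_le_sup le_rfl (MeasurableSpace.comap_mono (ℱ.le ⊤))) le_rfl
    exact h2.comp (((measurable_snd.subtype_mk (h := fun _ => Set.mem_Iic.2 le_top))).prodMk measurable_fst)
  refine ⟨hm.aestronglyMeasurable, ?_⟩
  have h : eLpNorm (fun z : Ω × TimeInterval T => v z.2 z.1) 2 (μ.prod (lebesgue T)) ^ 2 < ∞ := by
    rw [eLpNorm_two_sq_eq_ofReal, lintegral_prod _ (hm.pow_const 2).ennreal_ofReal.aemeasurable]
    exact hv.square_integrable
  by_contra hc
  rw [not_lt, top_le_iff] at hc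
  simp [hc] at h

lemma ae_integrable_path [IsProbabilityMeasure μ] {f : TimeInterval T → Ω → ℝ}
    (hf : MemLp (fun z : Ω × TimeInterval T => f z.2 z.1) 2 (μ.prod (lebesgue T))) :
    ∀ᵐ ω ∂μ, Integrable (fun t => f t ω) (lebesgue T) :=
  (hf.integrable (by norm_num)).prod_right_ae

end Moments

/-! ### Martingale increments vanish under conditioning -/

section ConditionalExpectation

variable {Ω : Type*} {mΩ : MeasurableSpace Ω} {μ : Measure Ω}
  {T : ℝ} [Fact (0 < T)] {ℱ : Filtration (TimeInterval T) mΩ}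

lemma condExp_martingale_sub {M : TimeInterval T → Ω → ℝ} (hM : Martingale M ℱ μ)
    {s t : TimeInterval T} (hst : s ≤ t) : μ[fun ω => M ⊤ ω - M t ω | ℱ s] =ᵐ[μ] 0 := by
  refine (condExp_sub (hM.integrable ⊤) (hM.integrable t) _).trans ?_
  filter_upwards [hM.2 s ⊤ le_top, hM.2 s t hst] with ω h1 h2
  simp [h1, h2]

variable [IsProbabilityMeasure μ]

/-- A random variable known at the present time has a smaller second moment than any random
variable obtained from it by removing a part with zero conditional expectation. -/
lemma eLpNorm_le_eLpNorm_sub {m : MeasurableSpace Ω} (hm : m ≤ mΩ) {v R : Ω → ℝ}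
    (hv : StronglyMeasurable[m] v) (hR : Integrable R μ) (h0 : μ[R | m] =ᵐ[μ] 0) :
    eLpNorm v 2 μ ≤ eLpNorm (fun ω => v ω - R ω) 2 μ := by
  -- Integrability of `v` is not given; it follows from `v = (v - R) + R` once `v - R` is in `L²`.
  by_cases hfin : eLpNorm (fun ω => v ω - R ω) 2 μ = ∞
  · simp [hfin]
  have hW : MemLp (fun ω => v ω - R ω) 2 μ :=
    ⟨(hv.mono hm).aestronglyMeasurable.sub hR.1, lt_top_iff_ne_top.2 hfin⟩
  have hWi : Integrable (fun ω => v ω - R ω) μ := hW.integrable (by norm_num)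
  have hvi : Integrable v μ := by
    refine (hWi.add hR).congr (ae_of_all _ fun ω => ?_)
    simp
  have h1 : μ[fun ω => v ω - R ω | m] =ᵐ[μ] v := by
    refine (condExp_sub hvi hR m).trans ?_
    rw [condExp_of_stronglyMeasurable hm hv hvi]
    filter_upwards [h0] with ω hω
    simp [hω]
  rw [← eLpNorm_congr_ae h1]
  exact eLpNorm_condExp_le_eLpNorm _ (by norm_num)

lemma integrable_prod_of_martingale {K : TimeInterval T → Ω → ℝ}
    (hK : IsSquareIntegrableMartingale ℱ μ K) :
    Integrable (fun z : Ω × TimeInterval T => K z.2 z.1) (μ.prod (lebesgue T)) := by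
  have hT : 0 < T := Fact.out
  have hm : Measurable (fun z : Ω × TimeInterval T => K z.2 z.1) :=
    measurable_uncurry_of_isCadlag hT.le
      (fun t => ((hK.martingale.1 t).mono (ℱ.le t)).measurable) hK.cadlag
  refine ⟨hm.aestronglyMeasurable, ?_⟩
  rw [HasFiniteIntegral, lintegral_prod_symm _ hm.enorm.aemeasurable]
  -- `K t` is a conditional expectation of `K ⊤`, which contracts `L¹`.
  have hb : ∀ t, ∫⁻ ω, ‖K t ω‖ₑ ∂μ ≤ ∫⁻ ω, ‖K ⊤ ω‖ₑ ∂μ := fun t => by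
    rw [← eLpNorm_one_eq_lintegral_enorm, ← eLpNorm_one_eq_lintegral_enorm,
      ← eLpNorm_congr_ae (hK.martingale.2 t ⊤ le_top)]
    exact eLpNorm_condExp_le_eLpNorm _ le_rfl
  refine (lintegral_mono hb).trans_lt ?_
  rw [lintegral_const, lebesgue_univ]
  exact ENNReal.mul_lt_top (hK.martingale.integrable ⊤).2 ENNReal.ofReal_lt_top

lemma integrable_prod_weighted_increment {K : TimeInterval T → Ω → ℝ}
    (hK : IsSquareIntegrableMartingale ℱ μ K) {w : TimeInterval T → ℝ} (hw : Continuous w) :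
    Integrable (fun z : Ω × TimeInterval T => w z.2 * (K ⊤ z.1 - K z.2 z.1))
      (μ.prod (lebesgue T)) := by
  obtain ⟨C, hC⟩ := isCompact_univ.exists_bound_of_continuousOn hw.continuousOn
  exact (((hK.martingale.integrable ⊤).comp_fst (lebesgue T)).sub
    (integrable_prod_of_martingale hK)).bdd_mul
    (hw.measurable.comp measurable_snd).aestronglyMeasurable (ae_of_all _ fun z => hC z.2 trivial)

lemma integrable_integral_weighted_increment {K : TimeInterval T → Ω → ℝ}
    (hK : IsSquareIntegrableMartingale ℱ μ K) {w : TimeInterval T → ℝ} (hw : Continuous w)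
    (S : Set (TimeInterval T)) :
    Integrable (fun ω => ∫ s in S, w s * (K ⊤ ω - K s ω) ∂(lebesgue T)) μ := by
  have h := (integrable_prod_weighted_increment hK hw).mono_measure
    (μ := μ.prod ((lebesgue T).restrict S)) (Measure.prod_mono le_rfl Measure.restrict_le_self)
  exact h.integral_prod_left

/-- By Fubini on `B ∈ ℱ t`, it suffices that `K ⊤ - K s` has integral zero over `B` for each `s >
t`. -/
lemma condExp_integral_weighted_increment {K : TimeInterval T → Ω → ℝ}
    (hK : IsSquareIntegrableMartingale ℱ μ K) {w : TimeInterval T → ℝ} (hw : Continuous w)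
    (t : TimeInterval T) :
    μ[fun ω => ∫ s in Set.Ioi t, w s * (K ⊤ ω - K s ω) ∂(lebesgue T) | ℱ t] =ᵐ[μ] 0 := by
  refine (ae_eq_condExp_of_forall_setIntegral_eq (ℱ.le t)
    (integrable_integral_weighted_increment hK hw _) (g := 0) (fun s _ _ => integrableOn_zero) ?_
    aestronglyMeasurable_zero).symm
  intro B hB _
  have hi : Integrable (fun z : Ω × TimeInterval T => w z.2 * (K ⊤ z.1 - K z.2 z.1))
      ((μ.restrict B).prod ((lebesgue T).restrict (Set.Ioi t))) :=
    (integrable_prod_weighted_increment hK hw).mono_measure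
      (Measure.prod_mono Measure.restrict_le_self Measure.restrict_le_self)
  rw [integral_integral_swap hi]
  simp only [Pi.zero_apply, integral_zero]
  symm
  refine integral_eq_zero_of_ae ?_
  filter_upwards [ae_restrict_mem measurableSet_Ioi] with s hs
  have hts : t ≤ s := le_of_lt hs
  have h0 : ∫ ω in B, (K ⊤ ω - K s ω) ∂μ = 0 := by
    have hd : Integrable (fun ω => K ⊤ ω - K s ω) μ :=
      (hK.martingale.integrable ⊤).sub (hK.martingale.integrable s)
    rw [← setIntegral_condExp (ℱ.le t) hd hB, integral_eq_zero_of_ae]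
    exact ae_restrict_of_ae (condExp_martingale_sub hK.martingale hts)
  simp only [integral_const_mul, h0, mul_zero, Pi.zero_apply]

end ConditionalExpectation

/-! ### `L²` bounds for the price increments -/

section Semimartingale

variable {Ω : Type*} {mΩ : MeasurableSpace Ω} {μ : Measure Ω} [IsProbabilityMeasure μ]
  {T : ℝ} [Fact (0 < T)] {ℱ : Filtration (TimeInterval T) mΩ}

/-- `E[L_t²] ≤ E[⟨L⟩_T]`. -/
lemma lintegral_sq_le_of_quadraticVariation {L Q : TimeInterval T → Ω → ℝ}
    (hL0 : ∀ ω, L ⊥ ω = 0) (hQ : IsPredictableQuadraticVariation ℱ μ L Q)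
    (hfin : ∫⁻ ω, ENNReal.ofReal (Q ⊤ ω) ∂μ < ∞) (t : TimeInterval T) :
    ∫⁻ ω, ENNReal.ofReal (L t ω ^ 2) ∂μ ≤ ∫⁻ ω, ENNReal.ofReal (Q ⊤ ω) ∂μ := by
  obtain ⟨τ, hτ, hmart⟩ := hQ.localMartingale.locally_martingale
  have hQpos : ∀ s ω, 0 ≤ Q s ω := fun s ω => (hQ.zero ω).symm.le.trans (hQ.monotone ω bot_le)
  have hQm : AEMeasurable (Q ⊤) μ :=
    ((hQ.predictable.isStronglyProgressive.stronglyAdapted ⊤).mono (ℱ.le ⊤)).measurable.aemeasurable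
  have hQi : Integrable (Q ⊤) μ := by
    refine ⟨hQm.aestronglyMeasurable, ?_⟩
    rwa [hasFiniteIntegral_iff_ofReal (ae_of_all _ (hQpos ⊤))]
  set S : ℕ → TimeInterval T → Ω → ℝ := fun n => stoppedProcess
    (fun i => {ω | ⊥ < τ n ω}.indicator (fun ω => L i ω ^ 2 - Q i ω)) (τ n) with hS
  have hSval : ∀ n s ω, S n s ω = {ω | ⊥ < τ n ω}.indicator
      (fun ω' => L ((min (s : WithTop (TimeInterval T)) (τ n ω)).untopA) ω' ^ 2
        - Q ((min (s : WithTop (TimeInterval T)) (τ n ω)).untopA) ω') ω := fun n s ω => rfl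
  have hS0 : ∀ n ω, S n ⊥ ω = 0 := by
    intro n ω
    rw [hSval]
    have : (min ((⊥ : TimeInterval T) : WithTop (TimeInterval T)) (τ n ω)).untopA = ⊥ := by
      rw [WithTop.coe_bot, min_eq_left bot_le]
      rfl
    rw [this]
    simp [Set.indicator, hL0, hQ.zero]
  have hSint : ∀ n s, ∫ ω, S n s ω ∂μ = 0 := by
    intro n s
    have h := (hmart n).setIntegral_eq (bot_le (a := s)) (MeasurableSet.univ)
    simp only [Measure.restrict_univ] at h
    have h2 : ∫ ω, S n ⊥ ω ∂μ = ∫ ω, S n s ω ∂μ := h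
    rw [← h2]
    simp [hS0]
  -- The stopped process is at least `-Q ⊤`. Adding `Q ⊤` makes it nonnegative with expectation `E[Q
  -- ⊤]` for every `n`, so Fatou's lemma applies.
  have hSge : ∀ n s ω, 0 ≤ S n s ω + Q ⊤ ω := by
    intro n s ω
    rw [hSval]
    by_cases hω : ω ∈ {ω | ⊥ < τ n ω}
    · rw [Set.indicator_of_mem hω]
      have := hQ.monotone ω (le_top (a := (min (s : WithTop (TimeInterval T)) (τ n ω)).untopA))
      simp only at this
      have := sq_nonneg (L ((min (s : WithTop (TimeInterval T)) (τ n ω)).untopA) ω)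
      linarith
    · rw [Set.indicator_of_notMem hω, zero_add]
      exact hQpos _ _
  have hSi : ∀ n s, Integrable (S n s) μ := fun n s => (hmart n).integrable s
  have hE : ∀ n, ∫⁻ ω, ENNReal.ofReal (S n t ω + Q ⊤ ω) ∂μ = ∫⁻ ω, ENNReal.ofReal (Q ⊤ ω) ∂μ := by
    intro n
    have hadd : Integrable (fun ω => S n t ω + Q ⊤ ω) μ := (hSi n t).add hQi
    rw [← ofReal_integral_eq_lintegral_ofReal hadd (ae_of_all _ (hSge n t)),
      ← ofReal_integral_eq_lintegral_ofReal hQi (ae_of_all _ (hQpos ⊤))]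
    rw [integral_add (hSi n t) hQi, hSint, zero_add]
  have hev : ∀ᵐ ω ∂μ, ∀ᶠ n in atTop, S n t ω = L t ω ^ 2 - Q t ω := by
    filter_upwards [hτ.tendsto_top] with ω hω
    -- The two tops differ: the time `T` lies strictly below the top adjoined by `WithTop`, so
    -- stopping eventually has no effect on `[0,T]`.
    have h1 : ∀ᶠ n in atTop, ((⊤ : TimeInterval T) : WithTop (TimeInterval T)) < τ n ω :=
      hω.eventually_const_lt (WithTop.coe_lt_top _)
    filter_upwards [h1] with n hn
    have hmem : ω ∈ {ω | ⊥ < τ n ω} := lt_of_le_of_lt bot_le hn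
    rw [hSval, Set.indicator_of_mem hmem, min_eq_left]
    · rfl
    · exact (WithTop.coe_le_coe.2 le_top).trans hn.le
  calc ∫⁻ ω, ENNReal.ofReal (L t ω ^ 2) ∂μ
      ≤ ∫⁻ ω, liminf (fun n => ENNReal.ofReal (S n t ω + Q ⊤ ω)) atTop ∂μ := by
        refine lintegral_mono_ae ?_
        filter_upwards [hev] with ω hω
        refine le_liminf_of_le (by isBoundedDefault) ?_
        filter_upwards [hω] with n hn
        rw [hn]
        refine ENNReal.ofReal_le_ofReal ?_
        have := hQ.monotone ω (le_top (a := t))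
        simp only at this
        linarith
    _ ≤ liminf (fun n => ∫⁻ ω, ENNReal.ofReal (S n t ω + Q ⊤ ω) ∂μ) atTop :=
        lintegral_liminf_le' fun n => ((hSi n t).1.aemeasurable.add hQm).ennreal_ofReal
    _ = ∫⁻ ω, ENNReal.ofReal (Q ⊤ ω) ∂μ := by simp [hE]

/-- The increments of an `ℋ²` semimartingale are bounded in `L²`. -/
lemma IsH2Semimartingale.exists_eLpNorm_le {P : TimeInterval T → Ω → ℝ}
    (hP : IsH2Semimartingale ℱ μ P) :
    ∃ C : ℝ, 0 ≤ C ∧ ∀ t, eLpNorm (fun ω => P ⊤ ω - P t ω) 2 μ ≤ ENNReal.ofReal C := by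
  obtain ⟨L, A, Q, hL, hL0, hA, hA0, hdec, hQ, hfin⟩ := hP.decomposition
  set q : ℝ≥0∞ := ∫⁻ ω, ENNReal.ofReal (Q ⊤ ω) ∂μ with hq
  set a : ℝ≥0∞ := ∫⁻ ω, (eVariationOn (fun t => A t ω) Set.univ) ^ 2 ∂μ with ha
  obtain ⟨hqf, haf⟩ := ENNReal.add_lt_top.1 hfin
  have hLm : ∀ t, AEStronglyMeasurable (L t) μ := fun t =>
    ((hL.adapted t).mono (ℱ.le t)).aestronglyMeasurable
  have hAm : ∀ t, AEStronglyMeasurable (A t) μ := fun t =>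
    ((hA.predictable.isStronglyProgressive.stronglyAdapted t).mono (ℱ.le t)).aestronglyMeasurable
  -- Only finiteness of the constant matters, so `b + 1` stands in for the square root of `b`.
  have hroot : ∀ {f : Ω → ℝ} {b : ℝ≥0∞}, eLpNorm f 2 μ ^ 2 ≤ b → eLpNorm f 2 μ ≤ b + 1 := by
    intro f b hb
    rcases le_total (eLpNorm f 2 μ) 1 with h | h
    · exact h.trans le_add_self
    · refine le_trans ?_ (hb.trans le_self_add)
      rw [sq]
      exact le_mul_of_one_le_left (zero_le) h
  have hLb : ∀ t, eLpNorm (L t) 2 μ ≤ q + 1 := fun t => hroot (by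
    rw [eLpNorm_two_sq_eq_ofReal]
    exact lintegral_sq_le_of_quadraticVariation hL0 hQ hqf t)
  have hAb : ∀ t, eLpNorm (fun ω => A ⊤ ω - A t ω) 2 μ ≤ a + 1 := fun t => hroot (by
    rw [eLpNorm_two_sq]
    refine lintegral_mono fun ω => pow_le_pow_left₀ (zero_le) ?_ 2
    have h := eVariationOn.edist_le (fun t => A t ω) (Set.mem_univ (⊤ : TimeInterval T))
      (Set.mem_univ t)
    rwa [edist_eq_enorm_sub] at h)
  have hC : (q + 1 + (q + 1)) + (a + 1) ≠ ∞ := by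
    simp [hqf.ne, haf.ne]
  refine ⟨((q + 1 + (q + 1)) + (a + 1)).toReal, ENNReal.toReal_nonneg, fun t => ?_⟩
  rw [ENNReal.ofReal_toReal hC]
  have heq : (fun ω => P ⊤ ω - P t ω) =ᵐ[μ] (L ⊤ - L t) + fun ω => A ⊤ ω - A t ω := by
    filter_upwards [hdec] with ω hω
    simp only [Pi.add_apply, Pi.sub_apply]
    rw [hω ⊤, hω t]
    ring
  rw [eLpNorm_congr_ae heq]
  refine (eLpNorm_add_le ((hLm _).sub (hLm _)) ((hAm _).sub (hAm _)) (by norm_num)).trans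
    (add_le_add ?_ (hAb t))
  exact (eLpNorm_sub_le (hLm _) (hLm _) (by norm_num)).trans (add_le_add (hLb _) (hLb _))

end Semimartingale

/-! ### Closing the estimates for both games -/

section Estimates

variable {Ω : Type*} {mΩ : MeasurableSpace Ω} {μ : Measure Ω} {T : ℝ}

/-- Closing a linear estimate with small coefficient. -/
lemma add_mul_le_two_mul {t θ B j : ℝ} (hθ : 0 ≤ θ) (hB : 0 ≤ B)
    (hj : 0 ≤ j) (hs : t * θ ≤ 1 / 2) (h : j ≤ t * (B + θ * j)) : B + θ * j ≤ 2 * B := by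
  -- Since `t * θ * j ≤ j / 2`, half of `j` is absorbed. Multiplying by `θ` then gives `θ * j ≤ 2 *
  -- (t * θ) * B ≤ B`.
  have h1 : j ≤ 2 * (t * B) := by nlinarith
  nlinarith [mul_le_mul_of_nonneg_left h1 hθ, mul_le_mul_of_nonneg_right hs hB]

lemma isCadlag_const (c : ℝ) : IsCadlag (fun _ : TimeInterval T => c) := fun _ =>
  ⟨continuousWithinAt_const, c, tendsto_const_nhds⟩

lemma limsup_secondMoment_lt_top {w : (N : ℕ) → Fin N → TimeInterval T → Ω → ℝ} {D : ℝ}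
    (h : ∀ N, 2 ≤ N → ∀ i t, eLpNorm (w N i t) 2 μ ≤ ENNReal.ofReal D) :
    limsup (fun N : ℕ => ⨆ i : Fin N, ⨆ t : TimeInterval T,
      ∫⁻ ω, ENNReal.ofReal (w N i t ω ^ 2) ∂μ) atTop < ∞ := by
  refine lt_of_le_of_lt (limsup_le_of_le (by isBoundedDefault)
    (a := ENNReal.ofReal D ^ 2) ?_) (ENNReal.pow_lt_top ENNReal.ofReal_lt_top)
  filter_upwards [eventually_ge_atTop 2] with N hN
  refine iSup_le fun i => iSup_le fun t => ?_
  rw [← eLpNorm_two_sq_eq_ofReal]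
  exact pow_le_pow_left₀ (zero_le) (h N hN i t) 2

variable [IsProbabilityMeasure μ]

/-- The total volume of the average speed is at most the average of the total volumes. -/
lemma eLpNorm_totalVolume_average_le {N : ℕ} (hN : N ≠ 0) {u : Fin N → TimeInterval T → Ω → ℝ}
    (hu : ∀ i, MemLp (fun z : Ω × TimeInterval T => u i z.2 z.1) 2 (μ.prod (lebesgue T))) {j : ℝ}
    (hj : ∀ i, eLpNorm (totalVolume (u i)) 2 μ ≤ ENNReal.ofReal j) :
    eLpNorm (totalVolume fun t ω => 1 / (N : ℝ) * ∑ i, u i t ω) 2 μ ≤ ENNReal.ofReal j := by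
  have hN0 : (0 : ℝ) < N := by positivity
  have hsum : eLpNorm (fun ω => ∑ i, totalVolume (u i) ω) 2 μ ≤ ENNReal.ofReal (N * j) := by
    have h := eLpNorm_sum_le (p := 2) (μ := μ) (s := Finset.univ)
      (f := fun i => totalVolume (u i))
      (fun i _ => aestronglyMeasurable_totalVolume (hu i).1) (by norm_num)
    have e : (∑ i, totalVolume (u i)) = fun ω => ∑ i, totalVolume (u i) ω := by
      ext ω; simp
    rw [e] at h
    refine h.trans ((Finset.sum_le_sum fun i _ => hj i).trans_eq ?_)
    rw [ENNReal.ofReal_mul hN0.le]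
    simp
  have h2 := eLpNorm_const_mul_le_ofReal (c := 1 / (N : ℝ)) (by positivity) hsum
  have e : 1 / (N : ℝ) * (N * j) = j := by field_simp
  rw [e] at h2
  refine le_trans (eLpNorm_mono_ae_real ?_) h2
  filter_upwards [ae_all_iff.2 fun i => ae_integrable_path (hu i)] with ω hω
  have h0 : 0 ≤ totalVolume (fun t ω => 1 / (N : ℝ) * ∑ i, u i t ω) ω :=
    integral_nonneg fun _ => abs_nonneg _
  rw [Real.norm_eq_abs, abs_of_nonneg h0]
  simp only [totalVolume, abs_mul, abs_of_pos (one_div_pos.2 hN0), integral_const_mul]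
  refine mul_le_mul_of_nonneg_left ?_ (by positivity)
  rw [← integral_finsetSum _ fun i _ => (hω i).abs]
  refine integral_mono (integrable_finsetSum _ fun i _ => hω i).abs
    (integrable_finsetSum _ fun i _ => (hω i).abs) fun t => ?_
  exact Finset.abs_sum_le_sum_abs _ _

variable [Fact (0 < T)] {ℱ : Filtration (TimeInterval T) mΩ}

/-- The second moments of the trading speed of one player are controlled by those of the total
volumes traded by this player and by the market. With `c = 0`, `Z = K = 0` this is the mean field
system, with `c = γκ/N` the `N`-player system. -/
lemma eLpNorm_speed_le {p : Parameters} (hp : p.Positive) {c x j k C : ℝ} (hc : 0 ≤ c)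
    (hj : 0 ≤ j) (hk : 0 ≤ k) (hC : 0 ≤ C) {u ν X Y Z K M P : TimeInterval T → Ω → ℝ}
    (hP : StronglyAdapted ℱ P)
    (hPC : ∀ t, eLpNorm (fun ω => P ⊤ ω - P t ω) 2 μ ≤ ENNReal.ofReal C)
    (hu : Admissible ℱ μ u)
    (hν : MemLp (fun z : Ω × TimeInterval T => ν z.2 z.1) 2 (μ.prod (lebesgue T)))
    (hX : ∀ ω, IsCadlag fun t => X t ω) (hY : ∀ ω, IsCadlag fun t => Y t ω)
    (hZ : ∀ ω, IsCadlag fun t => Z t ω) (hK : IsSquareIntegrableMartingale ℱ μ K)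
    (hM : IsSquareIntegrableMartingale ℱ μ M)
    (eX : ∀ᵐ ω ∂μ, ∀ t, X t ω = x - timeIntegral (fun s => u s ω) t)
    (eY : ∀ᵐ ω ∂μ, ∀ t, Y t ω = p.y +
      timeIntegral (fun s => -p.ρ * Y s ω + p.γ * ν s ω) t)
    (eu : ∀ᵐ ω ∂μ, ∀ t, u t ω = u ⊥ ω + (P t ω - P ⊥ ω) / (2 * p.lam) +
      timeIntegral (fun s => p.κ * p.ρ / (2 * p.lam) * Y s ω
        - p.κ * p.γ / (2 * p.lam) * ν s ω + c / (2 * p.lam) * u s ω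
        - p.φ / p.lam * X s ω + p.ρ / (2 * p.lam) * Z s ω) t + (M t ω - M ⊥ ω))
    (uT : ∀ᵐ ω ∂μ, u ⊤ ω = p.ϱ / p.lam * X ⊤ ω - p.κ / (2 * p.lam) * Y ⊤ ω)
    (eZ : ∀ᵐ ω ∂μ, ∀ t, Z t ω = Z ⊥ ω +
      timeIntegral (fun s => p.ρ * Z s ω + c * u s ω) t + (K t ω - K ⊥ ω))
    (ZT : ∀ᵐ ω ∂μ, Z ⊤ ω = 0)
    (hju : eLpNorm (totalVolume u) 2 μ ≤ ENNReal.ofReal j)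
    (hkν : eLpNorm (totalVolume ν) 2 μ ≤ ENNReal.ofReal k) (t : TimeInterval T) :
    eLpNorm (u t) 2 μ ≤ ENNReal.ofReal ((p.ϱ / p.lam + p.φ / p.lam * T) * (|x| + j)
      + p.κ / (2 * p.lam) * (p.y + p.γ * k) + 1 / (2 * p.lam) * C + c / (2 * p.lam) * j) := by
  have hT : 0 < T := Fact.out
  obtain ⟨hlam, hγ, hκ, hρ, hϱ, hφ, hy⟩ := hp
  have hw : Continuous (fun s : TimeInterval T => Real.exp (-p.ρ * (s - t))) := by fun_prop
  -- The part of `u t` that conditioning on `ℱ t` removes.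
  set R : Ω → ℝ := fun ω => p.ρ / (2 * p.lam) *
    (∫ s in Set.Ioi t, Real.exp (-p.ρ * (s - t)) * (K ⊤ ω - K s ω) ∂(lebesgue T))
      - (M ⊤ ω - M t ω) with hR
  have i1 : Integrable (fun ω => p.ρ / (2 * p.lam) *
      (∫ s in Set.Ioi t, Real.exp (-p.ρ * (s - t)) * (K ⊤ ω - K s ω) ∂(lebesgue T))) μ :=
    (integrable_integral_weighted_increment hK hw (Set.Ioi t)).const_mul _
  have i2 : Integrable (fun ω => M ⊤ ω - M t ω) μ :=
    (hM.martingale.integrable ⊤).sub (hM.martingale.integrable t)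
  have hR0 : μ[R | ℱ t] =ᵐ[μ] 0 := by
    refine (condExp_sub i1 i2 _).trans ?_
    have h1 := condExp_smul (μ := μ) (p.ρ / (2 * p.lam))
      (fun ω => ∫ s in Set.Ioi t, Real.exp (-p.ρ * (s - t)) * (K ⊤ ω - K s ω) ∂(lebesgue T)) (ℱ t)
    filter_upwards [h1, condExp_integral_weighted_increment hK hw t,
      condExp_martingale_sub hM.martingale (le_refl t)] with ω a1 a2 a3
    rw [Pi.smul_apply, a2] at a1
    simp only [Pi.sub_apply, a3]
    simp only [Pi.zero_apply, smul_zero, sub_zero] at a1 ⊢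
    exact a1
  refine (eLpNorm_le_eLpNorm_sub (ℱ.le t) (hu.progressive.stronglyAdapted t) (i1.sub i2)
    hR0).trans ?_
  have mu := aestronglyMeasurable_totalVolume hu.memLp.1
  have mν := aestronglyMeasurable_totalVolume hν.1
  have mP : AEStronglyMeasurable (fun ω => |P ⊤ ω - P t ω|) μ :=
    (((hP ⊤).mono (ℱ.le ⊤)).sub ((hP t).mono (ℱ.le t))).norm.aestronglyMeasurable
  have nP : eLpNorm (fun ω => |P ⊤ ω - P t ω|) 2 μ ≤ ENNReal.ofReal C := by
    have h := eLpNorm_norm (p := 2) (μ := μ) (fun ω => P ⊤ ω - P t ω)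
    simp only [Real.norm_eq_abs] at h
    rw [h]
    exact hPC t
  have bound : eLpNorm (fun ω => (p.ϱ / p.lam + p.φ / p.lam * T) * (|x| + totalVolume u ω)
      + p.κ / (2 * p.lam) * (p.y + p.γ * totalVolume ν ω)
      + 1 / (2 * p.lam) * |P ⊤ ω - P t ω| + c / (2 * p.lam) * totalVolume u ω) 2 μ ≤
      ENNReal.ofReal ((p.ϱ / p.lam + p.φ / p.lam * T) * (|x| + j)
      + p.κ / (2 * p.lam) * (p.y + p.γ * k) + 1 / (2 * p.lam) * C + c / (2 * p.lam) * j) := by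
    have m1 : AEStronglyMeasurable (fun ω => (p.ϱ / p.lam + p.φ / p.lam * T) *
        (|x| + totalVolume u ω)) μ := (aestronglyMeasurable_const.add mu).const_mul _
    have m2 : AEStronglyMeasurable (fun ω => p.κ / (2 * p.lam) *
        (p.y + p.γ * totalVolume ν ω)) μ :=
      (aestronglyMeasurable_const.add (mν.const_mul _)).const_mul _
    refine eLpNorm_add_le_ofReal ((m1.add m2).add (mP.const_mul _)) (mu.const_mul _)
      (by positivity) (by positivity) ?_ (eLpNorm_const_mul_le_ofReal (by positivity) hju)
    refine eLpNorm_add_le_ofReal (m1.add m2) (mP.const_mul _)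
      (by positivity) (by positivity) ?_ (eLpNorm_const_mul_le_ofReal (by positivity) nP)
    refine eLpNorm_add_le_ofReal m1 m2 (by positivity) (by positivity)
      (eLpNorm_const_mul_le_ofReal (by positivity) ?_)
      (eLpNorm_const_mul_le_ofReal (by positivity) ?_)
    · exact eLpNorm_add_le_ofReal aestronglyMeasurable_const mu (abs_nonneg _) hj
        (eLpNorm_const_le_ofReal (abs_nonneg _)) hju
    · exact eLpNorm_add_le_ofReal aestronglyMeasurable_const (mν.const_mul _) hy.le (by positivity)
        (eLpNorm_const_le_ofReal hy.le) (eLpNorm_const_mul_le_ofReal hγ.le hkν)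
  refine le_trans (eLpNorm_mono_ae_real ?_) bound
  filter_upwards [eX, eY, eu, uT, eZ, ZT, ae_integrable_path hu.memLp, ae_integrable_path hν]
    with ω eX eY eu uT eZ ZT iu iν
  exact abs_speed_sub_le hlam hγ hκ hρ hϱ hφ hy hc iu iν (hX ω) (hY ω) (hZ ω) (hK.cadlag ω)
    eX eY eu uT eZ ZT t

/-- With `m` the maximum divided by `λ`, the hypothesis reads `320 m² max(T², 1) T² < 1`. As `320 >
16²`, both `m T` and `m T²` are at most `1/16`, and the left side is at most `2 m T + m T² ≤ 3/16`.
-/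
lemma smallness {p : Parameters} (hp : p.Positive)
    (hT : 20 * p.smallTimeConstant * max (T ^ 2) 1 * T ^ 2 < 1) :
    T * (p.ϱ / p.lam + p.φ / p.lam * T + p.κ * p.γ / p.lam) ≤ 1 / 2 := by
  have hT0 : 0 < T := Fact.out
  obtain ⟨hlam, hγ, hκ, hρ, hϱ, hφ, hy⟩ := hp
  rw [Parameters.smallTimeConstant] at hT
  set m₀ := max p.ϱ (max p.κ (max (p.ρ * p.κ) (max (p.κ * p.γ) (max p.φ p.ρ)))) with hm₀
  have h1 : p.ϱ ≤ m₀ := by simp [hm₀]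
  have h2 : p.φ ≤ m₀ := by simp [hm₀]
  have h3 : p.κ * p.γ ≤ m₀ := by simp [hm₀]
  set m := m₀ / p.lam with hm
  have hm0 : 0 < m := div_pos (hϱ.trans_le h1) hlam
  have h1' : p.ϱ / p.lam ≤ m := div_le_div_of_nonneg_right h1 hlam.le
  have h2' : p.φ / p.lam ≤ m := div_le_div_of_nonneg_right h2 hlam.le
  have h3' : p.κ * p.γ / p.lam ≤ m := div_le_div_of_nonneg_right h3 hlam.le
  have hmT : 0 < m ^ 2 * T ^ 2 := by positivity
  have e1 : m * T ≤ 1 / 16 := by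
    have h : 320 * (m * T) ^ 2 < 1 := by
      nlinarith [mul_le_mul_of_nonneg_left (le_max_right (T ^ 2) 1) hmT.le]
    by_contra hlt
    push Not at hlt
    nlinarith
  have e2 : m * T * T ≤ 1 / 16 := by
    have h : 320 * (m * T * T) ^ 2 < 1 := by
      nlinarith [mul_le_mul_of_nonneg_left (le_max_left (T ^ 2) 1) hmT.le]
    by_contra hlt
    push Not at hlt
    nlinarith
  have a1 := mul_le_mul_of_nonneg_right h1' hT0.le
  have a2 := mul_le_mul_of_nonneg_right h2' (mul_pos hT0 hT0).le
  have a3 := mul_le_mul_of_nonneg_right h3' hT0.le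
  nlinarith

/-- Second moment bound for the `N`-player equilibrium, with a constant independent of `N`. -/
lemma SolvesNPlayerFBSDE.eLpNorm_le {p : Parameters} (hp : p.Positive)
    (hT : 20 * p.smallTimeConstant * max (T ^ 2) 1 * T ^ 2 < 1) {C D : ℝ} (hC : 0 ≤ C)
    (hD : 0 ≤ D) {P : TimeInterval T → Ω → ℝ} (hP : StronglyAdapted ℱ P)
    (hPC : ∀ t, eLpNorm (fun ω => P ⊤ ω - P t ω) 2 μ ≤ ENNReal.ofReal C)
    {N : ℕ} (hN : N ≠ 0) {x : Fin N → ℝ} (hx : ∀ i, |x i| ≤ D)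
    {u : Fin N → TimeInterval T → Ω → ℝ} (h : SolvesNPlayerFBSDE p ℱ μ P N x u)
    (i : Fin N) (t : TimeInterval T) :
    eLpNorm (u i t) 2 μ ≤ ENNReal.ofReal (2 * ((p.ϱ / p.lam + p.φ / p.lam * T) * D
      + p.κ / (2 * p.lam) * p.y + 1 / (2 * p.lam) * C)) := by
  have hT0 : 0 < T := Fact.out
  have hN1 : (1 : ℝ) ≤ N := by exact_mod_cast Nat.one_le_iff_ne_zero.2 hN
  have hN0 : (0 : ℝ) < N := by positivity
  have := Fin.pos_iff_nonempty.1 (Nat.pos_of_ne_zero hN)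
  have hsm := smallness hp hT
  obtain ⟨hlam, hγ, hκ, hρ, hϱ, hφ, hy⟩ := id hp
  obtain ⟨hu, X, Y, Z, M, K, hX, hY, hZ, hM, hK, eX, eY, eu, uT, eZ, ZT⟩ := h
  -- The players are coupled through their average, so the estimate is closed for the player with
  -- the largest volume norm.
  obtain ⟨i₀, hi₀⟩ := Finite.exists_max fun i => (eLpNorm (totalVolume (u i)) 2 μ).toReal
  set j := (eLpNorm (totalVolume (u i₀)) 2 μ).toReal with hjdef
  have hj : 0 ≤ j := ENNReal.toReal_nonneg
  have hfin : ∀ i, eLpNorm (totalVolume (u i)) 2 μ < ∞ := fun i =>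
    eLpNorm_totalVolume_lt_top (hu i).memLp
  have hju : ∀ i, eLpNorm (totalVolume (u i)) 2 μ ≤ ENNReal.ofReal j := fun i => by
    rw [← ENNReal.ofReal_toReal (hfin i).ne]
    exact ENNReal.ofReal_le_ofReal (hi₀ i)
  set ν : TimeInterval T → Ω → ℝ := fun t ω => 1 / (N : ℝ) * ∑ i, u i t ω with hν
  have hνL : MemLp (fun z : Ω × TimeInterval T => ν z.2 z.1) 2 (μ.prod (lebesgue T)) :=
    (memLp_finsetSum _ fun i _ => (hu i).memLp).const_mul _
  set B : ℝ := (p.ϱ / p.lam + p.φ / p.lam * T) * D + p.κ / (2 * p.lam) * p.y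
    + 1 / (2 * p.lam) * C with hB
  have hB0 : 0 ≤ B := by positivity
  set θ : ℝ := p.ϱ / p.lam + p.φ / p.lam * T + p.κ * p.γ / p.lam with hθ
  have hθ0 : 0 ≤ θ := by positivity
  have main : ∀ i t, eLpNorm (u i t) 2 μ ≤ ENNReal.ofReal (B + θ * j) := by
    intro i t
    refine (eLpNorm_speed_le hp (c := p.γ * p.κ / N) (x := x i) (by positivity) hj hj hC hP hPC
      (hu i) hνL (fun ω => (hX i).cadlag ω) (fun ω => hY.cadlag ω) (fun ω => (hZ i).cadlag ω)
      (hK i) (hM i) (eX i) ?_ ?_ (uT i) (eZ i) (ZT i) (hju i)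
      (eLpNorm_totalVolume_average_le hN (fun i => (hu i).memLp) hju) t).trans
      (ENNReal.ofReal_le_ofReal ?_)
    · filter_upwards [eY] with ω h t
      rw [h t]
      congr 2
      ext s
      simp only [hν]
      ring
    · filter_upwards [eu i] with ω h t
      rw [h t]
      congr 3
      ext s
      simp only [hν]
      -- Replacing the sum over `j ≠ i` by `N * ν` adds player `i`'s own rate; the term with `c =
      -- γκ/N` compensates for it.
      rw [← Finset.add_sum_erase _ _ (Finset.mem_univ i)]
      field_simp
      ring
    · have hx' := mul_le_mul_of_nonneg_left (hx i)
        (show 0 ≤ p.ϱ / p.lam + p.φ / p.lam * T by positivity)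
      -- The own-impact coefficient is bounded by its value at `N = 1`. With the equal contribution
      -- from `Y` it makes up the term `κγ/λ` of `θ`, free of `N`.
      have hc : p.γ * p.κ / N / (2 * p.lam) * j ≤ p.κ * p.γ / (2 * p.lam) * j := by
        refine mul_le_mul_of_nonneg_right ?_ hj
        refine div_le_div_of_nonneg_right ?_ (by positivity)
        rw [mul_comm p.κ]
        exact div_le_self (by positivity) hN1
      have e : p.κ * p.γ / p.lam * j = 2 * (p.κ * p.γ / (2 * p.lam) * j) := by ring
      have e' : p.κ / (2 * p.lam) * (p.y + p.γ * j) =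
        p.κ / (2 * p.lam) * p.y + p.κ * p.γ / (2 * p.lam) * j := by ring
      rw [e', mul_add (p.ϱ / p.lam + p.φ / p.lam * T)]
      rw [hB, hθ, add_mul _ (p.κ * p.γ / p.lam) j, e]
      linarith
  have hjle : j ≤ T * (B + θ * j) := by
    have h := eLpNorm_totalVolume_le hT0.le (hu i₀).memLp.1 (main i₀)
    exact ENNReal.toReal_le_of_le_ofReal (by positivity) h
  exact (main i t).trans (ENNReal.ofReal_le_ofReal
    (add_mul_le_two_mul hθ0 hB0 hj hsm hjle))

/-- Second moment bound for the mean field equilibrium, uniform over the players. -/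
lemma SolvesMeanFieldFBSDE.exists_eLpNorm_le {p : Parameters} (hp : p.Positive)
    (hT : 20 * p.smallTimeConstant * max (T ^ 2) 1 * T ^ 2 < 1) {C D : ℝ} (hC : 0 ≤ C)
    (hD : 0 ≤ D) {P : TimeInterval T → Ω → ℝ} (hP : StronglyAdapted ℱ P)
    (hPC : ∀ t, eLpNorm (fun ω => P ⊤ ω - P t ω) 2 μ ≤ ENNReal.ofReal C)
    {x : ℕ → ℝ} (hx : ∀ i, |x i| ≤ D) {v : ℕ → TimeInterval T → Ω → ℝ}
    (h : SolvesMeanFieldFBSDE p ℱ μ P x v) :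
    ∃ E : ℝ, ∀ i t, eLpNorm (v i t) 2 μ ≤ ENNReal.ofReal E := by
  have hT0 : 0 < T := Fact.out
  have hsm := smallness hp hT
  obtain ⟨hlam, hγ, hκ, hρ, hϱ, hφ, hy⟩ := id hp
  obtain ⟨hv, ν, X, Y, L, hν, hX, hY, hL, eX, eY, ev, vT, -⟩ := h
  -- `k` depends on the given solution but not on the player, so it is treated as data in `B`, and
  -- each player's estimate closes separately.
  set k := (eLpNorm (totalVolume ν) 2 μ).toReal with hkdef
  have hk : 0 ≤ k := ENNReal.toReal_nonneg
  have hkν : eLpNorm (totalVolume ν) 2 μ ≤ ENNReal.ofReal k := by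
    rw [hkdef, ENNReal.ofReal_toReal (eLpNorm_totalVolume_lt_top hν.memLp).ne]
  set B : ℝ := (p.ϱ / p.lam + p.φ / p.lam * T) * D + p.κ / (2 * p.lam) * (p.y + p.γ * k)
    + 1 / (2 * p.lam) * C with hB
  have hB0 : 0 ≤ B := by positivity
  set θ : ℝ := p.ϱ / p.lam + p.φ / p.lam * T with hθ
  have hθ0 : 0 ≤ θ := by positivity
  refine ⟨2 * B, fun i t => ?_⟩
  set j := (eLpNorm (totalVolume (v i)) 2 μ).toReal with hjdef
  have hj : 0 ≤ j := ENNReal.toReal_nonneg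
  have hjv : eLpNorm (totalVolume (v i)) 2 μ ≤ ENNReal.ofReal j := by
    rw [hjdef, ENNReal.ofReal_toReal (eLpNorm_totalVolume_lt_top (hv i).memLp).ne]
  have hK0 : IsSquareIntegrableMartingale ℱ μ (fun _ _ => (0 : ℝ)) :=
    ⟨martingale_zero _ _ _, fun _ => MemLp.zero', fun _ => isCadlag_const 0⟩
  have main : ∀ t, eLpNorm (v i t) 2 μ ≤ ENNReal.ofReal (B + θ * j) := by
    intro t
    refine (eLpNorm_speed_le hp (c := 0) (x := x i) (Z := fun _ _ => 0) le_rfl hj hk hC hP hPC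
      (hv i) hν.memLp (fun ω => (hX i).cadlag ω) (fun ω => hY.cadlag ω) (fun _ => isCadlag_const 0)
      hK0 (hL i) (eX i) eY ?_ (vT i) ?_ (by simp) hjv hkν t).trans (ENNReal.ofReal_le_ofReal ?_)
    · filter_upwards [ev i] with ω h t
      rw [h t]
      congr 3
      ext s
      ring
    · simp [timeIntegral]
    · have hx' := mul_le_mul_of_nonneg_left (hx i) hθ0
      rw [mul_add θ, hB, zero_div, zero_mul]
      linarith
  have hjle : j ≤ T * (B + θ * j) := by
    have h := eLpNorm_totalVolume_le hT0.le (hv i).memLp.1 main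
    exact ENNReal.toReal_le_of_le_ofReal (by positivity) h
  have hsm' : T * θ ≤ 1 / 2 := by
    refine (mul_le_mul_of_nonneg_left ?_ hT0.le).trans hsm
    rw [hθ]
    exact le_add_of_nonneg_right (by positivity)
  exact (main t).trans (ENNReal.ofReal_le_ofReal
    (add_mul_le_two_mul hθ0 hB0 hj hsm' hjle))

end Estimates

end PriceImpactGame

end
theorem proposition4p2 {Ω : Type*} {mΩ : MeasurableSpace Ω} (μ : Measure Ω)
    [IsProbabilityMeasure μ] (T : ℝ) [Fact (0 < T)]
    (ℱ : Filtration (PriceImpactGame.TimeInterval T) mΩ)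
    (hℱ : PriceImpactGame.UsualConditions ℱ μ)
    (P : PriceImpactGame.TimeInterval T → Ω → ℝ)
    (hP : PriceImpactGame.IsH2Semimartingale ℱ μ P)
    (p : PriceImpactGame.Parameters) (hp : p.Positive)
    (x : ℕ → ℝ) (hx : ∃ C : ℝ, ∀ i, |x i| ≤ C)
    (hT : 20 * p.smallTimeConstant * max (T ^ 2) 1 * T ^ 2 < 1) :
    (∀ u : (N : ℕ) → Fin N → PriceImpactGame.TimeInterval T → Ω → ℝ,
      (∀ N, 2 ≤ N → PriceImpactGame.SolvesNPlayerFBSDE p ℱ μ P N (fun i => x i) (u N)) →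
        limsup (fun N : ℕ => ⨆ i : Fin N, ⨆ t : PriceImpactGame.TimeInterval T,
          ∫⁻ ω, ENNReal.ofReal (u N i t ω ^ 2) ∂μ) atTop < ∞) ∧
    (∀ v : ℕ → PriceImpactGame.TimeInterval T → Ω → ℝ,
      PriceImpactGame.SolvesMeanFieldFBSDE p ℱ μ P x v →
        limsup (fun N : ℕ => ⨆ i : Fin N, ⨆ t : PriceImpactGame.TimeInterval T,
          ∫⁻ ω, ENNReal.ofReal (v i t ω ^ 2) ∂μ) atTop < ∞) := by
  obtain ⟨C, hC, hPC⟩ := hP.exists_eLpNorm_le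
  obtain ⟨D, hD⟩ := hx
  have hD0 : 0 ≤ D := (abs_nonneg _).trans (hD 0)
  refine ⟨fun u hu => ?_, fun v hv => ?_⟩
  · exact PriceImpactGame.limsup_secondMoment_lt_top fun N hN i t =>
      (hu N hN).eLpNorm_le hp hT hC hD0 hP.adapted hPC (by omega) (fun i => hD i) i t
  · obtain ⟨E, hE⟩ := hv.exists_eLpNorm_le hp hT hC hD0 hP.adapted hPC hD
    exact PriceImpactGame.limsup_secondMoment_lt_top (w := fun _ i => v i)
      fun N _ i t => hE i t
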